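/- **The game.** Two players divide a unit surplus in continuous time $t\in[0,\infty)$. The parameters are $a_1,a_2\in(0,1)$ with $D:=a_1+a_2-1>0$, $z_1,z_2\in(0,1)$, $r_1,r_2>0$, $\gamma_1\ge 0$, $0\le w_1<c_1<1$ and $0<k_2<1-w_1$. With probability $z_i$ player $i$ is justified in demanding $a_i$ and never concedes; otherwise he or she is unjustified. A justified player 1 challenges at Poisson rate $\gamma_1$; a justified player 2 sees every challenge. A strategy of the unjustified player 1 is a pair $\Sigma_1=(F_1,G_1)$ of right-continuous, nondecreasing functions $[0,\infty)\to[0,1]$ with $F_1+G_1\le 1$, where $F_1(t)$ and $G_1(t)$ are the probabilities of having conceded, respectively challenged, by time $t$. A strategy of the unjustified player 2 is a pair $\Sigma_2=(F_2,q_2)$, where $F_2:[0,\infty)\to[0,1]$ is right-continuous and nondecreasing, $F_2(t)$ being the probability of having conceded by time $t$, and $q_2:[0,\infty)\to[0,1]$ is measurable, $q_2(t)$ being the probability of yielding to a challenge at time $t$. For such a distribution function $F$ put $F(0^-)=0$ and $\Delta F(t)=F(t)-F(t^-)$; integrals $dF$ include the atom of size $F(0)$ at time $0$ whenever $0$ belongs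 to the domain of integration. Player 1's expected utilities from conceding and from challenging at time $t$ are $$U_1(t)=(1-z_2)\int_{[0,t)}a_1e^{-r_1s}\,dF_2(s)+[1-(1-z_2)F_2(t)]e^{-r_1t}(1-a_2)+(1-z_2)\,\Delta F_2(t)\,e^{-r_1t}\,\tfrac{a_1+1-a_2}{2},$$ $$V_1(t)=(1-z_2)\int_{[0,t]}a_1e^{-r_1s}\,dF_2(s)+[1-(1-z_2)F_2(t)]e^{-r_1t}(1-a_2-c_1D)+(1-z_2)[1-F_2(t)]e^{-r_1t}[(1-q_2(t))w_1+q_2(t)]D,$$ and his payoff is $u_1(\Sigma_1,\Sigma_2)=\int_{[0,\infty)}U_1\,dF_1+\int_{[0,\infty)}V_1\,dG_1$. Player 2's expected utility from conceding at time $t$ while yielding according to $q_2$ is $$\begin{aligned}U_2(t)={}&(1-z_1)\int_{[0,t)}a_2e^{-r_2s}\,dF_1(s)+z_1\int_0^t[1-a_1-(1-q_2(s))k_2D]\,e^{-r_2s}\gamma_1e^{-\gamma_1s}\,ds\\&+(1-z_1)\int_{[0,t)}\{1-a_1+(1-q_2(s))(1-w_1-k_2)D\}e^{-r_2s}\,dG_1(s)\\&+e^{-r_2t}(1-a_1)\big[1-(1-z_1)F_1(t)-(1-z_1)G_1(t^-)-z_1(1-e^{-\gamma_1t})\big]+(1-z_1)\,\Delta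 F_1(t)\,e^{-r_2t}\,\tfrac{a_2+1-a_1}{2},\end{aligned}$$ and her payoff is $u_2(\Sigma_2,\Sigma_1)=\int_{[0,\infty)}U_2\,dF_2$. An equilibrium is a pair $(\Sigma_1,\Sigma_2)$ such that $\Sigma_1$ maximizes $u_1(\cdot,\Sigma_2)$ over all strategies of player 1 and $\Sigma_2$ maximizes $u_2(\cdot,\Sigma_1)$ over all strategies of player 2. **Theorem.** An equilibrium exists. Moreover, there are finite times $T$ and $T_1\in[0,T)$, depending only on the parameters of the game, such that every equilibrium $(F_1,G_1,F_2,q_2)$ satisfies: 1. $F_1$ and $F_2$ are strictly increasing on $(0,T)$ and constant on $[T,\infty)$. 2. $F_1$ and $F_2$ have no atoms in $(0,T]$, and at most one of them has an atom at $t=0$. 3. (a) $G_1$ has no atoms in $[0,T]$, is strictly increasing on $[0,T_1]$ and constant on $[T_1,\infty)$. (b) If $\gamma_1>0$, then for almost every $t\in[0,T]$: $q_2(t)\in(0,1)$ if $t\in[0,T_1]$, and $q_2(t)=1$ if $t\in(T_1,T]$. 4. $F_1(T)+G_1(T_1)=1$ and $F_2(T)=1$. The equilibrium functions $F_1$, $F_2$,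 $G_1$ are unique, and if $\gamma_1>0$ then $q_2$ is unique almost everywhere on $[0,T]$. -/

import Mathlib

open Set MeasureTheory

noncomputable section

/-- A bargaining game with a one-sided ultimatum and single justified demands. Player `i` is
justified in demanding the share `aᵢ` with prior probability `zᵢ` and discounts at rate `rᵢ`; a
justified player 1 challenges at Poisson rate `γ₁`; `c₁` and `k₂` are the costs of challenging and
of seeing a challenge, as fractions of the disagreement `D = a₁ + a₂ - 1`; `w₁` is the probability
that an unjustified challenger wins in court against an unjustified defendant. -/
structure UltimatumGame where
  (a₁ a₂ z₁ z₂ r₁ r₂ γ₁ c₁ k₂ w₁ : ℝ)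
  a₁_pos : 0 < a₁
  a₁_lt_one : a₁ < 1
  a₂_gt : 1 - a₁ < a₂
  a₂_lt_one : a₂ < 1
  z₁_pos : 0 < z₁
  z₁_lt_one : z₁ < 1
  z₂_pos : 0 < z₂
  z₂_lt_one : z₂ < 1
  r₁_pos : 0 < r₁
  r₂_pos : 0 < r₂
  γ₁_nonneg : 0 ≤ γ₁
  w₁_nonneg : 0 ≤ w₁
  w₁_lt_c₁ : w₁ < c₁
  c₁_lt_one : c₁ < 1
  k₂_pos : 0 < k₂
  k₂_lt : k₂ < 1 - w₁

/-- A strategy of the unjustified player 1: `F t` and `G t` are the probabilities of having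
conceded, respectively challenged, by time `t` (inclusive). They are right-continuous, increasing,
and extended by `0` to negative times, so that `F 0` and `G 0` are the atoms at time `0` of the
Lebesgue–Stieltjes measures `F.measure` and `G.measure`. -/
structure Strategy₁ where
  F : StieltjesFunction ℝ
  G : StieltjesFunction ℝ
  F_neg : ∀ t < 0, F t = 0
  G_neg : ∀ t < 0, G t = 0
  F_add_G_le : ∀ t, F t + G t ≤ 1

/-- A strategy of the unjustified player 2: `F t` is the probability of having conceded by time `t`
(inclusive), extended by `0` to negative times, and `q t` is the probability of yielding to a
challenge at time `t` (only its values at `t ≥ 0` matter). -/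
structure Strategy₂ where
  F : StieltjesFunction ℝ
  q : ℝ → ℝ
  F_neg : ∀ t < 0, F t = 0
  F_le : ∀ t, F t ≤ 1
  q_measurable : Measurable q
  q_mem : ∀ t, q t ∈ Icc (0 : ℝ) 1

/-- The size of the atom at time `t` of a distribution function. -/
def jump (F : StieltjesFunction ℝ) (t : ℝ) : ℝ := F t - Function.leftLim F t

namespace UltimatumGame

variable (B : UltimatumGame)

/-- The amount of disagreement. -/
def D : ℝ := B.a₁ + B.a₂ - 1

/-- Time-zero expected utility of an unjustified player 1 from conceding at time `t ≥ 0`. The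
opponent's concessions strictly before `t` are collected; a simultaneous concession leads to an
equal split of the two outcomes. -/
def U₁ (t : ℝ) (σ₂ : Strategy₂) : ℝ :=
  (1 - B.z₂) * (∫ s in Ico 0 t, B.a₁ * Real.exp (-B.r₁ * s) ∂σ₂.F.measure)
    + (1 - (1 - B.z₂) * σ₂.F t) * Real.exp (-B.r₁ * t) * (1 - B.a₂)
    + (1 - B.z₂) * jump σ₂.F t * Real.exp (-B.r₁ * t) * ((B.a₁ + 1 - B.a₂) / 2)

/-- Time-zero expected utility of an unjustified player 1 from challenging at time `t ≥ 0`. If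
player 2 concedes at `t` too, the outcome is determined by the concession. -/
def V₁ (t : ℝ) (σ₂ : Strategy₂) : ℝ :=
  (1 - B.z₂) * (∫ s in Icc 0 t, B.a₁ * Real.exp (-B.r₁ * s) ∂σ₂.F.measure)
    + (1 - (1 - B.z₂) * σ₂.F t) * Real.exp (-B.r₁ * t) * (1 - B.a₂ - B.c₁ * B.D)
    + (1 - B.z₂) * (1 - σ₂.F t) * Real.exp (-B.r₁ * t)
        * (((1 - σ₂.q t) * B.w₁ + σ₂.q t) * B.D)

/-- Expected utility of an unjustified player 1. -/
def u₁ (σ₁ : Strategy₁) (σ₂ : Strategy₂) : ℝ :=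
  (∫ s in Ici 0, B.U₁ s σ₂ ∂σ₁.F.measure) + ∫ s in Ici 0, B.V₁ s σ₂ ∂σ₁.G.measure

/-- Time-zero expected utility of an unjustified player 2 from conceding at time `t ≥ 0` and
yielding to challenges according to `q`. The opponent's concessions and challenges strictly before
`t` are collected; a simultaneous concession leads to an equal split of the two outcomes, and if
player 1 challenges at `t` the outcome is determined by player 2's concession. -/
def U₂ (t : ℝ) (q : ℝ → ℝ) (σ₁ : Strategy₁) : ℝ :=
  (1 - B.z₁) * (∫ s in Ico 0 t, B.a₂ * Real.exp (-B.r₂ * s) ∂σ₁.F.measure)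
    + B.z₁ * (∫ s in (0 : ℝ)..t, (1 - B.a₁ - (1 - q s) * B.k₂ * B.D) * Real.exp (-B.r₂ * s)
        * (B.γ₁ * Real.exp (-B.γ₁ * s)))
    + (1 - B.z₁) * (∫ s in Ico 0 t,
        (1 - B.a₁ + (1 - q s) * (1 - B.w₁ - B.k₂) * B.D) * Real.exp (-B.r₂ * s) ∂σ₁.G.measure)
    + Real.exp (-B.r₂ * t) * (1 - B.a₁)
        * (1 - (1 - B.z₁) * σ₁.F t - (1 - B.z₁) * Function.leftLim σ₁.G t
            - B.z₁ * (1 - Real.exp (-B.γ₁ * t)))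
    + (1 - B.z₁) * jump σ₁.F t * Real.exp (-B.r₂ * t) * ((B.a₂ + 1 - B.a₁) / 2)

/-- Expected utility of an unjustified player 2. -/
def u₂ (σ₂ : Strategy₂) (σ₁ : Strategy₁) : ℝ :=
  ∫ s in Ici 0, B.U₂ s σ₂.q σ₁ ∂σ₂.F.measure

/-- Bayesian Nash equilibrium: the strategy of each unjustified player maximizes that player's
expected utility, over all strategies, against the strategy of the other. -/
def IsEquilibrium (σ₁ : Strategy₁) (σ₂ : Strategy₂) : Prop :=
  (∀ σ₁' : Strategy₁, B.u₁ σ₁' σ₂ ≤ B.u₁ σ₁ σ₂) ∧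
    ∀ σ₂' : Strategy₂, B.u₂ σ₂' σ₁ ≤ B.u₂ σ₂ σ₁

end UltimatumGame

end

noncomputable section

open Filter Topology Function

/-! The proof reduces the game to a war of attrition and then solves it explicitly. Integration by
parts writes the payoff from conceding at `t`, up to an affine change, as a value of waiting
(`U₁_eq`, `U₂_one_eq`): each concession of the opponent is worth `D`, while delay costs a flow
proportional to the probability that the game is still on. This value is constant when the opponent
concedes at the total hazard rate `rate₁` or `rate₂`. A player loses half of `D` by conceding at an
atom of the opponent, so nobody does.

Challenges are controlled by comparing two measures. Resisting earns player 2 `gainMeasure` against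
bluffs and loses `costMeasure` against justified challenges. A bluff that is sure to be resisted is
worse than conceding because `w₁ < c₁`, so player 1 bluffs only where player 2 yields with positive
probability. There player 2's optimality forces gain ≤ cost, hence gain ≤ cost everywhere
(`gain_le_cost`). So `G₁` has no atoms, and player 2 loses nothing by yielding to every challenge.
This gives both players the structure `WarSide`, for which a gap in one player's concessions stops
both forever (`WarSide.const_of_gap`). Concessions therefore increase strictly up to a common time
`T` and then end.

Given `T`, everything is explicit. `F₂` solves a linear equation backwards from `F₂(T) = 1`.
Challenging can pay only while `z₂ ≤ (1 - c₁)` times player 2's remaining probability, that is, up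
to `cutoff T`. Before the cutoff player 2 must resist with positive probability, so gain = cost,
which determines `G₁`. Then `F₁` is solved backwards from `F₁(T) + G₁(cutoff T) = 1`. Since at most
one player has an atom at time zero, the larger of the two initial remaining probabilities, `level
T`, equals 1. As `level` is strictly increasing, `T` is unique (`level_eq_one`, `strictMono_level`).
Conversely, the root of `level T = 1` exists by continuity, and the paths it defines form an
equilibrium (`isEquilibrium_equilibrium`). -/

lemma hasDerivAt_exp_mul (c x : ℝ) :
    HasDerivAt (fun s => Real.exp (c * s)) (c * Real.exp (c * x)) x := by
  simpa [mul_comm] using ((hasDerivAt_id x).const_mul c).exp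

lemma integral_exp_mul_const (r a b : ℝ) :
    ∫ u in a..b, r * Real.exp (-r * u) = Real.exp (-r * a) - Real.exp (-r * b) := by
  rw [intervalIntegral.integral_eq_sub_of_hasDerivAt (f := fun u => -Real.exp (-r * u))]
  · ring
  · intro x _
    exact (hasDerivAt_exp_mul (-r) x).neg.congr_deriv (by ring)
  · exact (by fun_prop : Continuous fun u => r * Real.exp (-r * u)).intervalIntegrable _ _

/-! ### Distribution functions on `[0,∞)` and their Stieltjes measures. -/

section Stieltjes

variable {F : StieltjesFunction ℝ}

lemma tendsto_atBot_of_neg (hF : ∀ t < 0, F t = 0) : Tendsto F atBot (𝓝 0) :=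
  tendsto_const_nhds.congr' (by
    filter_upwards [eventually_lt_atBot (0 : ℝ)] with t ht using (hF t ht).symm)

lemma stieltjes_nonneg (hF : ∀ t < 0, F t = 0) (t : ℝ) : 0 ≤ F t := by
  rcases lt_or_ge t 0 with h | h
  · rw [hF t h]
  · rw [← hF (-1) (by norm_num)]
    exact F.mono (by linarith)

lemma leftLim_of_neg (hF : ∀ t < 0, F t = 0) {t : ℝ} (ht : t ≤ 0) : leftLim F t = 0 := by
  refine leftLim_eq_of_tendsto (tendsto_const_nhds.congr' ?_)
  filter_upwards [self_mem_nhdsWithin] with s hs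
  exact (hF s (lt_of_lt_of_le hs ht)).symm

lemma jump_nonneg (F : StieltjesFunction ℝ) (t : ℝ) : 0 ≤ jump F t :=
  sub_nonneg.2 (F.mono.leftLim_le le_rfl)

lemma jump_le {s t : ℝ} (h : s < t) : jump F t ≤ F t - F s :=
  sub_le_sub_left (F.mono.le_leftLim h) _

lemma jump_zero (hF : ∀ t < 0, F t = 0) : jump F 0 = F 0 := by
  simp [jump, leftLim_of_neg hF]

lemma measure_Iic_of_neg (hF : ∀ t < 0, F t = 0) (t : ℝ) :
    F.measure (Iic t) = ENNReal.ofReal (F t) := by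
  simpa using F.measure_Iic (tendsto_atBot_of_neg hF) t

lemma measure_Iio_zero (hF : ∀ t < 0, F t = 0) : F.measure (Iio 0) = 0 := by
  rw [F.measure_Iio (tendsto_atBot_of_neg hF), leftLim_of_neg hF le_rfl]; simp

lemma ae_nonneg_of_neg (hF : ∀ t < 0, F t = 0) : ∀ᵐ t ∂F.measure, 0 ≤ t := by
  rw [ae_iff]
  convert measure_Iio_zero hF using 2
  ext; simp

lemma restrict_Ici_of_neg (hF : ∀ t < 0, F t = 0) : F.measure.restrict (Ici 0) = F.measure :=
  Measure.restrict_eq_self_of_ae_mem (ae_nonneg_of_neg hF)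

lemma isFiniteMeasure_of_le_one (hF : ∀ t < 0, F t = 0) (h1 : ∀ t, F t ≤ 1) :
    IsFiniteMeasure F.measure :=
  F.isFiniteMeasure_of_forall_abs_le (C := 1) fun t => by
    rw [abs_of_nonneg (stieltjes_nonneg hF t)]; exact h1 t

lemma tendsto_measure_real_univ (hF : ∀ t < 0, F t = 0) (h1 : ∀ t, F t ≤ 1) :
    Tendsto F atTop (𝓝 (F.measure.real univ)) := by
  have hb : BddAbove (range F) := ⟨1, by rintro _ ⟨t, rfl⟩; exact h1 t⟩
  have ht := tendsto_atTop_ciSup F.mono hb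
  have := F.measure_univ (tendsto_atBot_of_neg hF) ht
  rw [Measure.real, this, ENNReal.toReal_ofReal]
  · simpa using ht
  · simpa using (stieltjes_nonneg hF 0).trans (le_ciSup hb 0)

lemma measure_real_univ_eq (hF : ∀ t < 0, F t = 0) (h1 : ∀ t, F t ≤ 1) {T : ℝ}
    (hT : ∀ t, T ≤ t → F t = F T) : F.measure.real univ = F T :=
  tendsto_nhds_unique (tendsto_measure_real_univ hF h1)
    (tendsto_const_nhds.congr' (by
      filter_upwards [eventually_ge_atTop T] with t ht using (hT t ht).symm))

lemma ae_le_of_const {T : ℝ} (hT : ∀ t, T ≤ t → F t = F T) : ∀ᵐ t ∂F.measure, t ≤ T := by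
  rw [ae_iff]
  have : F.measure (Ioi T) = 0 := by
    rw [F.measure_Ioi (l := F T)]
    · simp
    · exact tendsto_const_nhds.congr' (by
        filter_upwards [eventually_ge_atTop T] with t ht using (hT t ht).symm)
  convert this using 2
  ext; simp

lemma eq_of_ae_notMem_Ioc {s t : ℝ} (hst : s ≤ t) (h : ∀ᵐ u ∂F.measure, u ∉ Ioc s t) :
    F t = F s := by
  have : F.measure (Ioc s t) = 0 := by
    rw [ae_iff] at h; simpa only [not_not, ofPred_mem_eq] using h
  rw [F.measure_Ioc, ENNReal.ofReal_eq_zero] at this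
  exact le_antisymm (by linarith) (F.mono hst)

lemma exists_mem_Ioc_of_lt {P : ℝ → Prop} (h : ∀ᵐ t ∂F.measure, P t) {s t : ℝ}
    (hst : F s < F t) : ∃ u ∈ Ioc s t, P u := by
  by_contra! hcon
  have hs : s ≤ t := by
    by_contra! h'
    exact absurd (F.mono h'.le) (not_le.2 hst)
  exact hst.ne' (eq_of_ae_notMem_Ioc hs (h.mono fun u hu hm => hcon u hm hu))

lemma measurable_stieltjes (F : StieltjesFunction ℝ) : Measurable F := F.mono.measurable

lemma intervalIntegrable_exp_mul (r : ℝ) (F : StieltjesFunction ℝ) (a b : ℝ) :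
    IntervalIntegrable (fun s => Real.exp (-r * s) * F s) volume a b :=
  (F.mono.intervalIntegrable).continuousOn_mul (by fun_prop)

/-- Integration by parts for a discounted distribution function. -/
lemma integral_exp_Ico (hF : ∀ t < 0, F t = 0) (r : ℝ) {t : ℝ} (ht : 0 ≤ t) :
    ∫ s in Ico 0 t, Real.exp (-r * s) ∂F.measure
      = Real.exp (-r * t) * leftLim F t + r * ∫ s in (0 : ℝ)..t, Real.exp (-r * s) * F s := by
  have hfin : F.measure (Ico 0 t) < ⊤ := by rw [F.measure_Ico]; exact ENNReal.ofReal_lt_top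
  have : IsFiniteMeasure (F.measure.restrict (Ico 0 t)) := ⟨by simp⟩
  have hreal : F.measure.real (Ico 0 t) = leftLim F t := by
    rw [Measure.real, F.measure_Ico, leftLim_of_neg hF le_rfl, sub_zero, ENNReal.toReal_ofReal]
    rw [← leftLim_of_neg hF le_rfl]
    exact F.mono.leftLim ht
  -- Fubini for this kernel: integrating in `u` gives `exp (-r s) - exp (-r t)`, and integrating in
  -- `s` first gives `r exp (-r u) F u`.
  set k : ℝ → ℝ → ℝ := fun s u => (Ici s).indicator (fun u => r * Real.exp (-r * u)) u with hk
  have hinner : ∀ s ∈ Ico 0 t, ∫ u in Ioc 0 t, k s u = Real.exp (-r * s) - Real.exp (-r * t) := by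
    intro s hs
    have hmeas : MeasurableSet (Ici s) := measurableSet_Ici
    rw [hk]
    simp only
    rw [setIntegral_indicator hmeas, ← integral_exp_mul_const,
      intervalIntegral.integral_of_le hs.2.le,
      ← integral_Icc_eq_integral_Ioc]
    rcases hs.1.eq_or_lt with h | h
    · subst h
      rw [inter_eq_left.2 (fun x hx => hx.1.le), integral_Icc_eq_integral_Ioc]
    · congr 2
      ext x
      simp only [mem_inter_iff, mem_Ioc, mem_Ici, mem_Icc]
      exact ⟨fun h => ⟨h.2, h.1.2⟩, fun h' => ⟨⟨h.trans_le h'.1, h'.2⟩, h'.1⟩⟩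
  have houter : ∀ u ∈ Ioo 0 t, ∫ s in Ico 0 t, k s u ∂F.measure
      = r * (Real.exp (-r * u) * F u) := by
    intro u hu
    have : ∀ s, k s u = (Iic u).indicator (fun _ => r * Real.exp (-r * u)) s := by
      intro s
      simp only [hk, indicator, mem_Ici, mem_Iic]
    simp_rw [this]
    rw [setIntegral_indicator measurableSet_Iic, setIntegral_const, smul_eq_mul]
    have : Ico 0 t ∩ Iic u = Icc 0 u := by
      ext x
      simp only [mem_inter_iff, mem_Ico, mem_Iic, mem_Icc]
      exact ⟨fun h => ⟨h.1.1, h.2⟩, fun h => ⟨⟨h.1, h.2.trans_lt hu.2⟩, h.2⟩⟩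
    rw [this, Measure.real, F.measure_Icc, leftLim_of_neg hF le_rfl, sub_zero,
      ENNReal.toReal_ofReal (stieltjes_nonneg hF u)]
    ring
  have hswap := integral_integral_swap (μ := F.measure.restrict (Ico 0 t))
    (ν := volume.restrict (Ioc 0 t)) (f := k) (by
      have hm : Measurable (uncurry k) := by
        have : uncurry k = {x : ℝ × ℝ | x.1 ≤ x.2}.indicator
            (fun x => r * Real.exp (-r * x.2)) := by
          ext ⟨s, u⟩
          simp [hk, indicator]
        rw [this]
        exact Measurable.indicator (by fun_prop) (measurableSet_le measurable_fst measurable_snd)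
      refine Integrable.of_bound (C := |r| * Real.exp (|r| * t)) hm.aestronglyMeasurable ?_
      rw [Measure.prod_restrict]
      filter_upwards [ae_restrict_mem (measurableSet_Ico.prod measurableSet_Ioc)] with x hx
      obtain ⟨s, u⟩ := x
      obtain ⟨-, hu⟩ := hx
      simp only [uncurry, hk, indicator]
      have : -r * u ≤ |r| * t := by
        have h1 : -r * u ≤ |r| * u := mul_le_mul_of_nonneg_right (neg_le_abs r) hu.1.le
        exact h1.trans (mul_le_mul_of_nonneg_left hu.2 (abs_nonneg r))
      split_ifs
      · rw [Real.norm_eq_abs, abs_mul, Real.abs_exp]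
        gcongr
      · rw [norm_zero]; positivity)
  rw [setIntegral_congr_fun measurableSet_Ico hinner] at hswap
  rw [integral_sub, setIntegral_const, hreal] at hswap
  rotate_left
  · refine Integrable.of_bound (C := Real.exp (|r| * t)) (by fun_prop) ?_
    filter_upwards [ae_restrict_mem measurableSet_Ico] with s hs
    rw [Real.norm_eq_abs, Real.abs_exp, Real.exp_le_exp]
    have h1 : -r * s ≤ |r| * s := mul_le_mul_of_nonneg_right (neg_le_abs r) hs.1
    exact h1.trans (mul_le_mul_of_nonneg_left hs.2.le (abs_nonneg r))
  · exact integrable_const _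
  rw [integral_Ioc_eq_integral_Ioo, setIntegral_congr_fun measurableSet_Ioo houter,
    ← integral_Ioc_eq_integral_Ioo, ← intervalIntegral.integral_of_le ht,
    intervalIntegral.integral_const_mul] at hswap
  rw [smul_eq_mul] at hswap
  linarith

lemma integrableOn_exp (r : ℝ) (F : StieltjesFunction ℝ) (t : ℝ) :
    IntegrableOn (fun s => Real.exp (-r * s)) (Icc 0 t) F.measure :=
  (by fun_prop : Continuous fun s => Real.exp (-r * s)).continuousOn.integrableOn_compact
    isCompact_Icc

lemma integral_exp_Icc (hF : ∀ t < 0, F t = 0) (r : ℝ) {t : ℝ} (ht : 0 ≤ t) :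
    ∫ s in Icc 0 t, Real.exp (-r * s) ∂F.measure
      = Real.exp (-r * t) * F t + r * ∫ s in (0 : ℝ)..t, Real.exp (-r * s) * F s := by
  have hu : Icc 0 t = Ico 0 t ∪ {t} := (Ico_union_right ht).symm
  have hi := integrableOn_exp r F t
  rw [hu] at hi ⊢
  rw [setIntegral_union (by simp) (measurableSet_singleton t) (hi.mono_set subset_union_left)
    (hi.mono_set subset_union_right), integral_exp_Ico hF r ht, integral_singleton, Measure.real,
    F.measure_singleton,
    ENNReal.toReal_ofReal (sub_nonneg.2 (F.mono.leftLim_le le_rfl)), smul_eq_mul]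
  ring

end Stieltjes

/-! ### Optimal mixtures. -/

/-- If payoffs are bounded by `M > 0` and a sub-probability earns `M`, it has full mass and earns
`M` almost surely. -/
lemma ae_eq_of_integral_add_eq {X : Type*} [MeasurableSpace X] {μ ν : Measure X}
    [IsFiniteMeasure μ] [IsFiniteMeasure ν] {U V : X → ℝ} {M : ℝ} (hM : 0 < M)
    (hU : ∀ᵐ x ∂μ, U x ≤ M) (hV : ∀ᵐ x ∂ν, V x ≤ M) (hm : μ.real univ + ν.real univ ≤ 1)
    (h : M ≤ (∫ x, U x ∂μ) + ∫ x, V x ∂ν) :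
    μ.real univ + ν.real univ = 1 ∧ (∀ᵐ x ∂μ, U x = M) ∧ ∀ᵐ x ∂ν, V x = M := by
  have key : ∀ (μ : Measure X) [IsFiniteMeasure μ] (U : X → ℝ), (∀ᵐ x ∂μ, U x ≤ M) →
      (∫ x, U x ∂μ) ≤ M * μ.real univ ∧
        (M * μ.real univ ≤ (∫ x, U x ∂μ) → ∀ᵐ x ∂μ, U x = M) := by
    intro μ _ U hU
    by_cases hi : Integrable U μ
    · have h1 : ∫ x, (M - U x) ∂μ = M * μ.real univ - ∫ x, U x ∂μ := by
        rw [integral_sub (integrable_const _) hi, integral_const, smul_eq_mul, mul_comm]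
      have h2 : 0 ≤ᵐ[μ] fun x => M - U x := hU.mono fun x hx => sub_nonneg.2 hx
      have h3 := integral_nonneg_of_ae h2
      refine ⟨by linarith, fun h4 => ?_⟩
      have h5 := (integral_eq_zero_iff_of_nonneg_ae h2 ((integrable_const _).sub hi)).1
        (by linarith)
      filter_upwards [h5] with x hx
      simp only [Pi.zero_apply] at hx
      linarith
    -- A non-integrable payoff has Bochner integral `0`, which can reach `M` times the mass only if
    -- the measure vanishes.
    · rw [integral_undef hi]
      have h0 : 0 ≤ μ.real univ := measureReal_nonneg
      refine ⟨by positivity, fun h4 => ?_⟩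
      have : μ.real univ = 0 := by nlinarith
      rw [measureReal_eq_zero_iff, Measure.measure_univ_eq_zero] at this
      simp [this]
  obtain ⟨h1, h1'⟩ := key μ U hU
  obtain ⟨h2, h2'⟩ := key ν V hV
  have h3 : M * (μ.real univ + ν.real univ) ≤ M * 1 := by gcongr
  have h4 : μ.real univ + ν.real univ = 1 :=
    le_antisymm hm (le_of_mul_le_mul_left (by linarith) hM)
  refine ⟨h4, h1' ?_, h2' ?_⟩ <;> nlinarith

lemma integral_add_le_of_le {X : Type*} [MeasurableSpace X] {μ ν : Measure X}
    [IsFiniteMeasure μ] [IsFiniteMeasure ν] {U V : X → ℝ} {M : ℝ} (hM : 0 < M)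
    (hU : ∀ᵐ x ∂μ, U x ≤ M) (hV : ∀ᵐ x ∂ν, V x ≤ M) (hm : μ.real univ + ν.real univ ≤ 1) :
    (∫ x, U x ∂μ) + ∫ x, V x ∂ν ≤ M := by
  by_contra! hlt
  obtain ⟨h1, h2, h3⟩ := ae_eq_of_integral_add_eq hM hU hV hm hlt.le
  rw [integral_congr_ae h2, integral_congr_ae h3, integral_const, integral_const, smul_eq_mul,
    smul_eq_mul, ← add_mul, h1, one_mul] at hlt
  exact lt_irrefl _ hlt

/-! ### The value of waiting. -/

/-- The value, up to normalization, of waiting until `t` for concessions distributed according to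
`F`: `p` is the opponent's probability of being unjustified, `C` the distribution function of the
payoff-neutral exits, `r` the discount rate, and `l` the critical concession rate. -/
def waitValue (p r l : ℝ) (F C : ℝ → ℝ) (t : ℝ) : ℝ :=
  p * Real.exp (-r * t) * F t
    + ∫ s in (0 : ℝ)..t, Real.exp (-r * s) * (p * r * F s - l * (1 - p * F s - C s))

section WaitValue

variable {p r l : ℝ} {F C : ℝ → ℝ}

lemma intervalIntegrable_waitRate (hF : ∀ a b, IntervalIntegrable F volume a b)
    (hC : ∀ a b, IntervalIntegrable C volume a b) (a b : ℝ) :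
    IntervalIntegrable
      (fun s => Real.exp (-r * s) * (p * r * F s - l * (1 - p * F s - C s))) volume a b :=
  ((((hF a b).const_mul _).sub
    (((intervalIntegrable_const.sub ((hF a b).const_mul _)).sub (hC a b)).const_mul _))
      ).continuousOn_mul (by fun_prop)

lemma waitValue_zero : waitValue p r l F C 0 = p * F 0 := by simp [waitValue]

lemma waitValue_sub (hF : ∀ a b, IntervalIntegrable F volume a b)
    (hC : ∀ a b, IntervalIntegrable C volume a b) (s t : ℝ) :
    waitValue p r l F C t - waitValue p r l F C s
      = p * Real.exp (-r * t) * F t - p * Real.exp (-r * s) * F s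
        + ∫ u in s..t, Real.exp (-r * u) * (p * r * F u - l * (1 - p * F u - C u)) := by
  have h := intervalIntegral.integral_interval_sub_left
    (intervalIntegrable_waitRate (p := p) (r := r) (l := l) hF hC 0 t)
    (intervalIntegrable_waitRate (p := p) (r := r) (l := l) hF hC 0 s)
  rw [← h, waitValue, waitValue]
  ring

/-- When `F` is constant its own contributions cancel, leaving only the cost of delay, `-l` times
the integral of the discounted survival probability. -/
lemma waitValue_lt_of_const (hF : ∀ a b, IntervalIntegrable F volume a b)
    (hC : ∀ a b, IntervalIntegrable C volume a b) (hl : 0 < l) {s t : ℝ} (hst : s < t)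
    (hc : ∀ u ∈ Icc s t, F u = F s) (hR : ∀ u ∈ Icc s t, 0 < 1 - p * F u - C u) :
    waitValue p r l F C t < waitValue p r l F C s := by
  rw [← sub_neg, waitValue_sub hF hC, hc t (right_mem_Icc.2 hst.le)]
  have hi : IntervalIntegrable (fun u => Real.exp (-r * u) * (1 - p * F u - C u)) volume s t :=
    ((intervalIntegrable_const.sub ((hF s t).const_mul _)).sub (hC s t)).continuousOn_mul
      (by fun_prop)
  have hpos : 0 < ∫ u in s..t, Real.exp (-r * u) * (1 - p * F u - C u) :=
    intervalIntegral.intervalIntegral_pos_of_pos_on hi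
      (fun u hu => mul_pos (Real.exp_pos _) (hR u (Ioo_subset_Icc_self hu))) hst
  have heq : ∫ u in s..t, Real.exp (-r * u) * (p * r * F u - l * (1 - p * F u - C u))
      = (p * F s) * (∫ u in s..t, r * Real.exp (-r * u))
        - l * ∫ u in s..t, Real.exp (-r * u) * (1 - p * F u - C u) := by
    rw [← intervalIntegral.integral_const_mul, ← intervalIntegral.integral_const_mul,
      ← intervalIntegral.integral_sub _ (hi.const_mul _)]
    · refine intervalIntegral.integral_congr fun u hu => ?_
      rw [uIcc_of_le hst.le] at hu
      simp only [hc u hu]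
      ring
    · exact (by fun_prop : Continuous fun u => p * F s * (r * Real.exp (-r * u))).intervalIntegrable
        _ _
  rw [heq, integral_exp_mul_const]
  nlinarith

lemma continuous_waitIntegral (hF : ∀ a b, IntervalIntegrable F volume a b)
    (hC : ∀ a b, IntervalIntegrable C volume a b) :
    Continuous fun t => ∫ s in (0 : ℝ)..t,
      Real.exp (-r * s) * (p * r * F s - l * (1 - p * F s - C s)) :=
  intervalIntegral.continuous_primitive (intervalIntegrable_waitRate hF hC) 0

/-- Only the term outside the integral can jump, so one-sided limits of the value are governed by
those of `F`. -/
lemma tendsto_waitValue {f : Filter ℝ} {t y : ℝ} (hF : ∀ a b, IntervalIntegrable F volume a b)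
    (hC : ∀ a b, IntervalIntegrable C volume a b) (hf : f ≤ 𝓝 t) (h : Tendsto F f (𝓝 y)) :
    Tendsto (waitValue p r l F C) f
      (𝓝 (waitValue p r l F C t - p * Real.exp (-r * t) * (F t - y))) := by
  have h1 : Tendsto (fun t => p * Real.exp (-r * t)) f (𝓝 (p * Real.exp (-r * t))) :=
    ((by fun_prop : Continuous fun t => p * Real.exp (-r * t)).tendsto t).mono_left hf
  have h2 := ((continuous_waitIntegral (p := p) (r := r) (l := l) hF hC).tendsto t).mono_left hf
  have h3 : waitValue p r l F C t - p * Real.exp (-r * t) * (F t - y) = p * Real.exp (-r * t) * y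
      + ∫ s in (0 : ℝ)..t, Real.exp (-r * s) * (p * r * F s - l * (1 - p * F s - C s)) := by
    simp only [waitValue]
    ring
  rw [h3]
  exact (h1.mul h).add h2

/-- Two distributions that both make the opponent indifferent on `[0,T]`, and that agree at `T`,
agree on `[0,T]`. -/
lemma eq_of_waitValue_const {F' : ℝ → ℝ} {T m m' : ℝ} (hp : p ≠ 0)
    (hF : ∀ a b, IntervalIntegrable F volume a b) (hF' : ∀ a b, IntervalIntegrable F' volume a b)
    {C' : ℝ → ℝ} (hC : ∀ a b, IntervalIntegrable C volume a b)
    (hC' : ∀ a b, IntervalIntegrable C' volume a b) (hCC : ∀ t ∈ Icc 0 T, C t = C' t)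
    (h : ∀ t ∈ Icc 0 T, waitValue p r l F C t = m)
    (h' : ∀ t ∈ Icc 0 T, waitValue p r l F' C' t = m')
    (hT : F T = F' T) : ∀ t ∈ Icc 0 T, F t = F' t := by
  -- The discounted difference solves `y = const - (r + l) ∫ y`. No regularity of `F` is assumed;
  -- continuity of `y` on `[0,T]` follows from this equation.
  set y : ℝ → ℝ := fun t => Real.exp (-r * t) * (F t - F' t) with hy
  have hyi : ∀ a b, IntervalIntegrable y volume a b := fun a b =>
    ((hF a b).sub (hF' a b)).continuousOn_mul (by fun_prop)
  have heq : ∀ t ∈ Icc 0 T, y t = (m - m') / p - (r + l) * ∫ s in (0 : ℝ)..t, y s := by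
    intro t ht
    have h1 := h t ht
    have h2 := h' t ht
    have h3 : (∫ s in (0 : ℝ)..t, Real.exp (-r * s) * (p * r * F s - l * (1 - p * F s - C s)))
        - (∫ s in (0 : ℝ)..t, Real.exp (-r * s) * (p * r * F' s - l * (1 - p * F' s - C' s)))
        = p * (r + l) * ∫ s in (0 : ℝ)..t, y s := by
      rw [← intervalIntegral.integral_sub (intervalIntegrable_waitRate hF hC 0 t)
        (intervalIntegrable_waitRate hF' hC' 0 t), ← intervalIntegral.integral_const_mul]
      refine intervalIntegral.integral_congr fun s hs => ?_
      rw [uIcc_of_le ht.1] at hs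
      simp only [hy, hCC s ⟨hs.1, hs.2.trans ht.2⟩]
      ring
    rw [waitValue] at h1 h2
    rw [eq_sub_iff_add_eq, eq_div_iff hp]
    have h4 : p * y t = p * Real.exp (-r * t) * F t - p * Real.exp (-r * t) * F' t := by
      simp only [hy]; ring
    linarith
  set J : ℝ → ℝ := fun t => ∫ s in (0 : ℝ)..t, y s with hJ
  have hJc : Continuous J := intervalIntegral.continuous_primitive hyi 0
  have hyc : ContinuousOn y (Icc 0 T) :=
    ContinuousOn.congr (f := fun t => (m - m') / p - (r + l) * J t) (by fun_prop) heq
  have hJd : ∀ t ∈ Ico 0 T, HasDerivWithinAt J (y t) (Ici t) t := by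
    intro t ht
    have hcw : ContinuousWithinAt y (Ioi t) t := by
      refine ((hyc t (Ico_subset_Icc_self ht)).mono (s := Ioc t T) ?_).mono_of_mem_nhdsWithin ?_
      · exact fun x hx => ⟨ht.1.trans hx.1.le, hx.2⟩
      · exact Ioc_mem_nhdsGT ht.2
    refine intervalIntegral.integral_hasDerivWithinAt_right (hyi 0 t) (s := Ici t) (t := Ioi t)
      ?_ hcw
    refine ⟨Ioc t (t + 1), Ioc_mem_nhdsGT (by linarith), ?_⟩
    exact (hyi t (t + 1)).1.aestronglyMeasurable
  -- By the integrating factor, `exp ((r + l) t) * y t` is constant on `[0,T]`, and it vanishes at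
  -- `T`.
  have hconst := constant_of_has_deriv_right_zero
    (f := fun t => Real.exp ((r + l) * t) * ((m - m') / p - (r + l) * J t)) (a := 0) (b := T)
    (by fun_prop) (by
      intro t ht
      have h1 := (hasDerivAt_exp_mul (r + l) t).hasDerivWithinAt (s := Ici t)
      have h2 := h1.mul (((hJd t ht).const_mul (r + l)).const_sub ((m - m') / p))
      refine h2.congr_deriv ?_
      rw [heq t (Ico_subset_Icc_self ht)]
      ring)
  have hyT : y T = 0 := by simp [hy, hT]
  intro t ht
  have hTm : T ∈ Icc 0 T := ⟨ht.1.trans ht.2, le_rfl⟩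
  have hty : y t = 0 := by
    have h1 := (hconst t ht).trans (hconst T hTm).symm
    simp only [hJ] at h1
    rw [← heq t ht, ← heq T hTm, hyT, mul_zero] at h1
    exact (mul_eq_zero.1 h1).resolve_left (Real.exp_pos _).ne'
  have := (mul_eq_zero.1 hty).resolve_left (Real.exp_pos _).ne'
  linarith

/-- If the concession rate is always the critical one, waiting has a constant value. -/
lemma waitValue_eq_of_hasDerivWithinAt {T : ℝ} (hF : Continuous F) (hC : Continuous C)
    (hd : ∀ t ∈ Ico 0 T, HasDerivWithinAt (fun s => p * F s) (l * (1 - p * F t - C t)) (Ici t) t) :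
    ∀ t ∈ Icc 0 T, waitValue p r l F C t = p * F 0 := by
  intro t ht
  have hcont : Continuous fun s => Real.exp (-r * s) * (p * r * F s - l * (1 - p * F s - C s)) := by
    fun_prop
  have hprim := intervalIntegral.continuous_primitive (fun a b => hcont.intervalIntegrable
    (μ := volume) a b) 0
  rw [← waitValue_zero (p := p) (r := r) (l := l) (F := F) (C := C)]
  refine constant_of_has_deriv_right_zero (a := 0) (b := T) ?_ ?_ t ht
  · unfold waitValue
    fun_prop
  · intro t ht
    have h1 := (hasDerivAt_exp_mul (-r) t).hasDerivWithinAt (s := Ici t)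
    have h2 := (h1.mul (hd t ht)).add
      (intervalIntegral.integral_hasDerivAt_right (hcont.intervalIntegrable 0 t)
        (hcont.stronglyMeasurableAtFilter _ _) hcont.continuousAt).hasDerivWithinAt
    refine (h2.congr_deriv ?_).congr (fun s _ => ?_) ?_
    · ring
    · simp only [waitValue, Pi.add_apply, Pi.mul_apply]; ring
    · simp only [waitValue, Pi.add_apply, Pi.mul_apply]; ring

end WaitValue

lemma stieltjes_intervalIntegrable (F : StieltjesFunction ℝ) (a b : ℝ) :
    IntervalIntegrable F volume a b := F.mono.intervalIntegrable

lemma waitValue_continuousWithinAt {p r l : ℝ} (F : StieltjesFunction ℝ) {C : ℝ → ℝ}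
    (hC : ∀ a b, IntervalIntegrable C volume a b) (t : ℝ) :
    ContinuousWithinAt (waitValue p r l F C) (Ici t) t := by
  have := tendsto_waitValue (p := p) (r := r) (l := l) (stieltjes_intervalIntegrable F) hC
    (nhdsWithin_le_nhds (s := Ici t)) (F.right_continuous t)
  simpa only [sub_self, mul_zero, sub_zero, ContinuousWithinAt] using this

/-- The value tends to `m` from the left, so an atom at `t` would lift it above its upper bound `m`.
-/
lemma jump_eq_zero_of_waitValue_eq {p r l m t : ℝ} (hp : 0 < p) (F : StieltjesFunction ℝ)
    {C : ℝ → ℝ} (hC : ∀ a b, IntervalIntegrable C volume a b) (ht : 0 < t)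
    (h : ∀ s ∈ Ico 0 t, waitValue p r l F C s = m) (hle : waitValue p r l F C t ≤ m) :
    jump F t = 0 ∧ waitValue p r l F C t = m := by
  have h1 := tendsto_waitValue (p := p) (r := r) (l := l) (stieltjes_intervalIntegrable F) hC
    (nhdsWithin_le_nhds (s := Iio t)) (F.mono.tendsto_leftLim t)
  have h2 : Tendsto (waitValue p r l F C) (𝓝[<] t) (𝓝 m) :=
    tendsto_const_nhds.congr' (by
      filter_upwards [Ico_mem_nhdsLT ht] with s hs using (h s hs).symm)
  have h3 := tendsto_nhds_unique h1 h2
  have h4 : 0 < p * Real.exp (-r * t) := by positivity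
  have h5 : 0 ≤ F t - leftLim F t := jump_nonneg F t
  have h6 : F t - leftLim F t = 0 := by nlinarith
  exact ⟨h6, by rw [h6] at h3; linarith⟩

/-! ### The abstract war of attrition. -/

/-- One side of a war of attrition: `A` is the value to a player of waiting for the concessions `F`
of the opponent, `m` its supremum, and `G` the distribution of the player's own concessions. -/
structure WarSide (F G : StieltjesFunction ℝ) (A : ℝ → ℝ) (m : ℝ) : Prop where
  right_cont : ∀ t, 0 ≤ t → ContinuousWithinAt A (Ici t) t
  lt_of_const : ∀ s t, 0 ≤ s → s < t → F t = F s → A t < A s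
  le : ∀ t, 0 ≤ t → A t ≤ m
  ae : ∀ᵐ t ∂G.measure, A t = m ∧ jump F t = 0

namespace WarSide

variable {F G : StieltjesFunction ℝ} {A B : ℝ → ℝ} {m n : ℝ}

/-- After `s` the value has dropped below its bound. Constancy of `F` on the half-open interval
suffices, because `G` puts no mass at `t` if `F` has an atom there. -/
lemma const_of_leftLim (h : WarSide F G A m) {s t : ℝ} (hs : 0 ≤ s) (hst : s < t)
    (hF : ∀ u ∈ Ico s t, F u = F s) : G t = G s := by
  refine eq_of_ae_notMem_Ioc hst.le (h.ae.mono fun u hu hm => ?_)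
  have hFu : F u = F s := by
    rcases hm.2.eq_or_lt with hut | hut
    · have : leftLim F u = F s := by
        refine leftLim_eq_of_tendsto (tendsto_const_nhds.congr' ?_)
        filter_upwards [Ico_mem_nhdsLT hm.1] with v hv
        exact (hF v ⟨hv.1, hv.2.trans_le hm.2⟩).symm
      have h2 := hu.2
      rw [jump, this] at h2
      linarith
    · exact hF u ⟨hm.1.le, hut⟩
  have := h.lt_of_const s u hs hm.1 hFu
  exact absurd hu.1 (this.trans_le (h.le s hs)).ne

lemma const_of_eq (h : WarSide F G A m) {s t : ℝ} (hs : 0 ≤ s) (hst : s < t)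
    (hF : F t = F s) : G t = G s :=
  h.const_of_leftLim hs hst fun _ hu =>
    le_antisymm (hF ▸ F.mono hu.2.le) (F.mono hu.1)

/-- A gap in the concessions of one player extends to the right end of time. -/
lemma const_of_gap (h : WarSide F G A m) (h' : WarSide G F B n) {s t : ℝ} (hs : 0 ≤ s)
    (hst : s < t) (hF : F t = F s) : ∀ u, s ≤ u → F u = F s ∧ G u = G s := by
  have hall : ∀ u, s ≤ u → F u = F s := by
    by_contra! hcon
    obtain ⟨u, hsu, hu⟩ := hcon
    set K := {v | s ≤ v ∧ F v = F s} with hK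
    have hbdd : BddAbove K := by
      refine ⟨u, fun v hv => ?_⟩
      by_contra! huv
      exact hu (le_antisymm (hv.2 ▸ F.mono huv.le) (F.mono hsu))
    have htK : t ∈ K := ⟨hst.le, hF⟩
    set x := sSup K with hx
    have htx : t ≤ x := le_csSup hbdd htK
    have hsx : s < x := hst.trans_le htx
    have hlow : ∀ v ∈ Ico s x, F v = F s := by
      intro v hv
      obtain ⟨w, hw, hvw⟩ := exists_lt_of_lt_csSup ⟨t, htK⟩ hv.2
      exact le_antisymm (hw.2 ▸ F.mono hvw.le) (F.mono hv.1)
    -- Suppose the gap ends at `x`. Then `G`, and with it `F`, is constant up to and including `x`,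
    -- so the value at `x` is below `m`. By right-continuity it stays below `m` shortly after `x`,
    -- which extends the gap and contradicts the choice of `x`.
    have hG : G x = G s := h.const_of_leftLim hs hsx hlow
    have hFx : F x = F s := h'.const_of_eq hs hsx hG
    have hAx : A x < m := (h.lt_of_const s x hs hsx hFx).trans_le (h.le s hs)
    have hx0 : 0 ≤ x := hs.trans hsx.le
    have hev : ∀ᶠ v in 𝓝[≥] x, A v < m := (h.right_cont x hx0).eventually (gt_mem_nhds hAx)
    obtain ⟨w, hxw, hw⟩ := mem_nhdsGE_iff_exists_Ico_subset.1 hev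
    have hxw' : x < w := hxw
    obtain ⟨y, hxy, hyw⟩ := exists_between hxw'
    have hGy : G y = G x := eq_of_ae_notMem_Ioc hxy.le (h.ae.mono fun v hv hm =>
      absurd hv.1 (hw ⟨hm.1.le, hm.2.trans_lt hyw⟩).ne)
    have hFy : F y = F s := h'.const_of_eq hs (hsx.trans hxy) (hGy.trans hG)
    exact absurd (le_csSup hbdd (show y ∈ K from ⟨(hsx.trans hxy).le, hFy⟩)) (not_le.2 hxy)
  intro u hu
  refine ⟨hall u hu, ?_⟩
  rcases hu.eq_or_lt with rfl | hlt
  · rfl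
  · exact h.const_of_eq hs hlt (hall u hu)

/-- A value below `m` would stay below `m` just to the right of `t`, where `G` has mass. -/
lemma eq_of_strictMonoOn (h : WarSide F G A m) {T : ℝ} (hG : StrictMonoOn G (Ico 0 T)) :
    ∀ t ∈ Ico 0 T, A t = m := by
  intro t ht
  refine le_antisymm (h.le t ht.1) ?_
  by_contra! hlt
  have hev : ∀ᶠ v in 𝓝[≥] t, A v < m := (h.right_cont t ht.1).eventually (gt_mem_nhds hlt)
  obtain ⟨w, htw, hw⟩ := mem_nhdsGE_iff_exists_Ico_subset.1 hev
  obtain ⟨y, hty, hyw⟩ := exists_between (lt_min (show t < w from htw) ht.2)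
  have := hG ht ⟨ht.1.trans hty.le, hyw.trans_le (min_le_right _ _)⟩ hty
  obtain ⟨u, hu, hu'⟩ := exists_mem_Ioc_of_lt h.ae this
  exact absurd hu'.1 (hw ⟨hu.1.le, hu.2.trans_lt (hyw.trans_le (min_le_left _ _))⟩).ne

/-- In a war of attrition both players concede gradually until a common time `T`, and not
thereafter. -/
lemma exists_exit_time (h : WarSide F G A m) (h' : WarSide G F B n)
    (hb : ∃ K, ∀ T, 0 ≤ T → (∀ t ∈ Ico 0 T, A t = m) → T ≤ K) :
    ∃ T, 0 ≤ T ∧ StrictMonoOn F (Ico 0 T) ∧ StrictMonoOn G (Ico 0 T) ∧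
      (∀ t, T ≤ t → F t = F T) ∧ ∀ t, T ≤ t → G t = G T := by
  -- The times after which some concession is still to come. Before any of them there is no gap, so
  -- `A = m` there and `hb` bounds `K`; the exit time is its supremum.
  set K := {s | 0 ≤ s ∧ ∃ u, s < u ∧ F s < F u} with hK
  have hdown : ∀ s ∈ K, ∀ u v, 0 ≤ u → u < v → v ≤ s → F u < F v ∧ G u < G v := by
    rintro s ⟨-, w, hsw, hw⟩ u v hu huv hvs
    have hne : F u < F v := by
      refine lt_of_le_of_ne (F.mono huv.le) fun heq => ?_
      have hg := h.const_of_gap h' hu huv heq.symm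
      rw [(hg s (huv.le.trans hvs)).1, (hg w (by linarith)).1] at hw
      exact lt_irrefl _ hw
    refine ⟨hne, lt_of_le_of_ne (G.mono huv.le) fun heq => ?_⟩
    exact hne.ne' (h'.const_of_eq hu huv heq.symm)
  obtain ⟨b, hb⟩ := hb
  have hbdd : BddAbove K := by
    refine ⟨b, fun s hs => hb s hs.1 (h.eq_of_strictMonoOn ?_)⟩
    exact fun u hu v hv huv => (hdown s hs u v hu.1 huv hv.2.le).2
  rcases K.eq_empty_or_nonempty with hemp | hne
  · have hF : ∀ t, 0 ≤ t → F t = F 0 := by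
      intro t ht
      rcases ht.eq_or_lt with rfl | hlt
      · rfl
      by_contra hcon
      have : (0 : ℝ) ∈ K := ⟨le_rfl, t, hlt, lt_of_le_of_ne (F.mono ht) (Ne.symm hcon)⟩
      simp [hemp] at this
    refine ⟨0, le_rfl, by simp [StrictMonoOn], by simp [StrictMonoOn], hF, fun t ht => ?_⟩
    exact (h.const_of_gap h' le_rfl one_pos (hF 1 zero_le_one) t ht).2
  · obtain ⟨s₀, hs₀⟩ := hne
    have hT0 : 0 ≤ sSup K := hs₀.1.trans (le_csSup hbdd hs₀)
    have hmono : ∀ u ∈ Ico 0 (sSup K), ∀ v ∈ Ico 0 (sSup K), u < v → F u < F v ∧ G u < G v := by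
      intro u hu v hv huv
      obtain ⟨w, hw, hvw⟩ := exists_lt_of_lt_csSup ⟨s₀, hs₀⟩ hv.2
      exact hdown w hw u v hu.1 huv hvw.le
    have hFc : ∀ t, sSup K < t → ∀ u, t ≤ u → F u = F t := by
      intro t ht u hu
      rcases hu.eq_or_lt with rfl | hlt
      · rfl
      by_contra hcon
      have : t ∈ K := ⟨hT0.trans ht.le, u, hlt, lt_of_le_of_ne (F.mono hu) (Ne.symm hcon)⟩
      exact absurd (le_csSup hbdd this) (not_le.2 ht)
    have hFT : ∀ t, sSup K ≤ t → F t = F (sSup K) := by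
      intro t ht
      rcases ht.eq_or_lt with h0 | hlt
      · rw [h0]
      have h1 : Tendsto F (𝓝[>] sSup K) (𝓝 (F (sSup K))) :=
        (F.right_continuous _).mono_left (nhdsWithin_mono _ Ioi_subset_Ici_self)
      refine tendsto_nhds_unique (tendsto_const_nhds.congr' ?_) h1
      filter_upwards [Ioc_mem_nhdsGT hlt] with v hv
      exact hFc v hv.1 t hv.2
    refine ⟨sSup K, hT0, fun u hu v hv huv => (hmono u hu v hv huv).1,
      fun u hu v hv huv => (hmono u hu v hv huv).2, hFT, fun t ht => ?_⟩
    exact (h.const_of_gap h' hT0 (lt_add_one _) (hFT _ (by linarith)) t ht).2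

end WarSide

/-! ### Strategies and pure deviations. -/

lemma Strategy₁.F_le_one (σ : Strategy₁) (t : ℝ) : σ.F t ≤ 1 := by
  linarith [σ.F_add_G_le t, stieltjes_nonneg σ.G_neg t]

lemma Strategy₁.G_le_one (σ : Strategy₁) (t : ℝ) : σ.G t ≤ 1 := by
  linarith [σ.F_add_G_le t, stieltjes_nonneg σ.F_neg t]

instance (σ : Strategy₁) : IsFiniteMeasure σ.F.measure :=
  isFiniteMeasure_of_le_one σ.F_neg σ.F_le_one

instance (σ : Strategy₁) : IsFiniteMeasure σ.G.measure :=
  isFiniteMeasure_of_le_one σ.G_neg σ.G_le_one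

instance (σ : Strategy₂) : IsFiniteMeasure σ.F.measure :=
  isFiniteMeasure_of_le_one σ.F_neg σ.F_le

lemma Strategy₁.measure_add_le (σ : Strategy₁) :
    σ.F.measure.real univ + σ.G.measure.real univ ≤ 1 :=
  le_of_tendsto' ((tendsto_measure_real_univ σ.F_neg σ.F_le_one).add
    (tendsto_measure_real_univ σ.G_neg σ.G_le_one)) σ.F_add_G_le

lemma Strategy₂.measure_le (σ : Strategy₂) : σ.F.measure.real univ ≤ 1 :=
  le_of_tendsto' (tendsto_measure_real_univ σ.F_neg σ.F_le) σ.F_le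

/-- The strategy of conceding at time `t`. -/
def Strategy₁.concedeAt (t : ℝ) (ht : 0 ≤ t) : Strategy₁ where
  F := ProbabilityTheory.cdf (Measure.dirac t)
  G := 0
  F_neg s hs := by
    rw [ProbabilityTheory.cdf_eq_real, Measure.real, Measure.dirac_apply' _ measurableSet_Iic]
    simp [hs.trans_le ht]
  G_neg _ _ := rfl
  F_add_G_le s := by simpa using ProbabilityTheory.cdf_le_one _ s

/-- The strategy of challenging at time `t`. -/
def Strategy₁.challengeAt (t : ℝ) (ht : 0 ≤ t) : Strategy₁ where
  F := 0
  G := ProbabilityTheory.cdf (Measure.dirac t)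
  F_neg _ _ := rfl
  G_neg := (Strategy₁.concedeAt t ht).F_neg
  F_add_G_le s := by simpa using ProbabilityTheory.cdf_le_one _ s

/-- The strategy of conceding at time `t` and yielding according to `q`. -/
def Strategy₂.concedeAt (t : ℝ) (ht : 0 ≤ t) (q : ℝ → ℝ) (hq : Measurable q)
    (hq' : ∀ s, q s ∈ Icc (0 : ℝ) 1) : Strategy₂ where
  F := ProbabilityTheory.cdf (Measure.dirac t)
  q := q
  F_neg := (Strategy₁.concedeAt t ht).F_neg
  F_le := ProbabilityTheory.cdf_le_one _
  q_measurable := hq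
  q_mem := hq'

lemma integral_cdf_dirac {t : ℝ} (ht : 0 ≤ t) (f : ℝ → ℝ) :
    ∫ s in Ici 0, f s ∂(ProbabilityTheory.cdf (Measure.dirac t)).measure = f t := by
  rw [ProbabilityTheory.measure_cdf, restrict_dirac, if_pos (mem_Ici.2 ht),
    integral_dirac]

lemma integrableOn_mul_exp {μ : Measure ℝ} [IsLocallyFiniteMeasure μ] {f : ℝ → ℝ}
    (hf : Measurable f) (hb : ∀ s, f s ∈ Icc (0 : ℝ) 1) (r t : ℝ) :
    IntegrableOn (fun s => f s * Real.exp (-r * s)) (Ico 0 t) μ := by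
  have h : IntegrableOn (fun s => Real.exp (-r * s)) (Ico 0 t) μ :=
    ((by fun_prop : Continuous fun s => Real.exp (-r * s)).continuousOn.integrableOn_compact
      isCompact_Icc).mono_set Ico_subset_Icc_self
  refine Integrable.mono' h (by fun_prop) (ae_of_all _ fun s => ?_)
  rw [norm_mul, Real.norm_eq_abs, Real.norm_eq_abs, Real.abs_exp, abs_of_nonneg (hb s).1]
  exact mul_le_of_le_one_left (Real.exp_pos _).le (hb s).2

lemma one_sub_mem {q : ℝ → ℝ} (hq : ∀ s, q s ∈ Icc (0 : ℝ) 1) (s : ℝ) :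
    1 - q s ∈ Icc (0 : ℝ) 1 := ⟨by linarith [(hq s).2], by linarith [(hq s).1]⟩

lemma waitValue_eq {p r l : ℝ} {F C : ℝ → ℝ} (hF : ∀ a b, IntervalIntegrable F volume a b)
    (hC : ∀ a b, IntervalIntegrable C volume a b) (t : ℝ) :
    waitValue p r l F C t = p * Real.exp (-r * t) * F t
      + p * (r + l) * (∫ s in (0 : ℝ)..t, Real.exp (-r * s) * F s)
      + l * (∫ s in (0 : ℝ)..t, Real.exp (-r * s) * C s)
      - l * ∫ s in (0 : ℝ)..t, Real.exp (-r * s) := by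
  have h1 : IntervalIntegrable (fun s => Real.exp (-r * s) * F s) volume 0 t :=
    (hF 0 t).continuousOn_mul (by fun_prop)
  have h2 : IntervalIntegrable (fun s => Real.exp (-r * s) * C s) volume 0 t :=
    (hC 0 t).continuousOn_mul (by fun_prop)
  have h3 : IntervalIntegrable (fun s => Real.exp (-r * s)) volume 0 t :=
    (by fun_prop : Continuous fun s => Real.exp (-r * s)).intervalIntegrable _ _
  rw [waitValue, ← intervalIntegral.integral_const_mul, ← intervalIntegral.integral_const_mul,
    ← intervalIntegral.integral_const_mul, add_assoc,
    ← intervalIntegral.integral_add (h1.const_mul _) (h2.const_mul _), add_sub_assoc,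
    ← intervalIntegral.integral_sub ((h1.const_mul _).add (h2.const_mul _)) (h3.const_mul _)]
  congr 1
  refine intervalIntegral.integral_congr fun s _ => ?_
  ring

/-! ### Payoffs in terms of the value of waiting. -/

namespace UltimatumGame

variable (B : UltimatumGame)

lemma D_pos : 0 < B.D := by have := B.a₂_gt; unfold D; linarith

/-- The total rate of player 2's concessions that makes player 1 indifferent. -/
def rate₁ : ℝ := B.r₁ * (1 - B.a₂) / B.D

/-- The total rate of player 1's concessions that makes player 2 indifferent. -/
def rate₂ : ℝ := B.r₂ * (1 - B.a₁) / B.D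

lemma rate₁_pos : 0 < B.rate₁ :=
  div_pos (mul_pos B.r₁_pos (sub_pos.2 B.a₂_lt_one)) B.D_pos

lemma rate₂_pos : 0 < B.rate₂ :=
  div_pos (mul_pos B.r₂_pos (sub_pos.2 B.a₁_lt_one)) B.D_pos

/-- Player 1's normalized value of waiting. -/
def wait₁ (σ₂ : Strategy₂) : ℝ → ℝ :=
  waitValue (1 - B.z₂) B.r₁ B.rate₁ σ₂.F fun _ => 0

/-- The probability that player 1 has challenged by time `t`. -/
def challenged (G : ℝ → ℝ) (t : ℝ) : ℝ :=
  (1 - B.z₁) * G t + B.z₁ * (1 - Real.exp (-B.γ₁ * t))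

/-- Player 2's normalized value of waiting, while yielding to all challenges. -/
def wait₂ (σ₁ : Strategy₁) : ℝ → ℝ :=
  waitValue (1 - B.z₁) B.r₂ B.rate₂ σ₁.F (B.challenged σ₁.G)

/-- The expected benefit of seeing the challenges of an unjustified player 1. -/
def gainMeasure (G : StieltjesFunction ℝ) : Measure ℝ :=
  ENNReal.ofReal ((1 - B.z₁) * (1 - B.w₁ - B.k₂)) • G.measure

/-- The expected cost of seeing the challenges of a justified player 1. -/
def costMeasure : Measure ℝ :=
  volume.withDensity fun s => ENNReal.ofReal (B.z₁ * B.k₂ * (B.γ₁ * Real.exp (-B.γ₁ * s)))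

lemma gain_pos : 0 < (1 - B.z₁) * (1 - B.w₁ - B.k₂) :=
  mul_pos (sub_pos.2 B.z₁_lt_one) (by linarith [B.k₂_lt])

lemma cost_pos : 0 < B.z₁ * B.k₂ := mul_pos B.z₁_pos B.k₂_pos

instance : IsLocallyFiniteMeasure B.costMeasure :=
  IsLocallyFiniteMeasure.withDensity_ofReal (by fun_prop)

instance (G : StieltjesFunction ℝ) [IsFiniteMeasure G.measure] :
    IsFiniteMeasure (B.gainMeasure G) :=
  Measure.smul_finite _ ENNReal.ofReal_ne_top

lemma integral_exp (r : ℝ) (t : ℝ) :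
    r * (∫ s in (0 : ℝ)..t, Real.exp (-r * s)) = 1 - Real.exp (-r * t) := by
  rw [← intervalIntegral.integral_const_mul, integral_exp_mul_const]
  simp

/-- `wait₁` counts the opponent's atom at `t` in full, whereas an equal split yields only half of
its surplus `D`. -/
lemma U₁_eq (σ₂ : Strategy₂) {t : ℝ} (ht : 0 ≤ t) :
    B.U₁ t σ₂ = (1 - B.a₂) + B.D * (B.wait₁ σ₂ t
      - (1 - B.z₂) * Real.exp (-B.r₁ * t) * jump σ₂.F t / 2) := by
  have hD := B.D_pos.ne'
  have hl : B.D * B.rate₁ = B.r₁ * (1 - B.a₂) := by unfold rate₁; field_simp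
  have he := integral_exp B.r₁ t
  rw [U₁, wait₁, waitValue_eq (stieltjes_intervalIntegrable _) (fun _ _ => by simp),
    integral_const_mul, integral_exp_Ico σ₂.F_neg _ ht]
  have ha : B.a₁ = B.D + (1 - B.a₂) := by unfold D; ring
  have hj : leftLim σ₂.F t = σ₂.F t - jump σ₂.F t := by unfold jump; ring
  rw [ha, hj]
  simp only [mul_zero, intervalIntegral.integral_zero]
  linear_combination (-(1 - B.z₂) * (∫ s in (0 : ℝ)..t, Real.exp (-B.r₁ * s) * σ₂.F s)
    + (∫ s in (0 : ℝ)..t, Real.exp (-B.r₁ * s))) * hl + (1 - B.a₂) * he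

/-- The net gain, in units of `D`, from challenging rather than conceding right after `t`. -/
def challengeGain (F q t : ℝ) : ℝ :=
  Real.exp (-B.r₁ * t) * ((1 - B.z₂) * (1 - F) * (B.w₁ + q * (1 - B.w₁))
    - B.c₁ * (1 - (1 - B.z₂) * F))

/-- A challenger collects the whole of a simultaneous atom, so no jump correction appears. -/
lemma V₁_eq (σ₂ : Strategy₂) {t : ℝ} (ht : 0 ≤ t) :
    B.V₁ t σ₂ = (1 - B.a₂) + B.D * (B.wait₁ σ₂ t + B.challengeGain (σ₂.F t) (σ₂.q t) t) := by
  have hD := B.D_pos.ne'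
  have hl : B.D * B.rate₁ = B.r₁ * (1 - B.a₂) := by unfold rate₁; field_simp
  have he := integral_exp B.r₁ t
  rw [V₁, wait₁, waitValue_eq (stieltjes_intervalIntegrable _) (fun _ _ => by simp),
    integral_const_mul, integral_exp_Icc σ₂.F_neg _ ht, challengeGain]
  have ha : B.a₁ = B.D + (1 - B.a₂) := by unfold D; ring
  rw [ha]
  simp only [mul_zero, intervalIntegral.integral_zero]
  linear_combination (-(1 - B.z₂) * (∫ s in (0 : ℝ)..t, Real.exp (-B.r₁ * s) * σ₂.F s)
    + (∫ s in (0 : ℝ)..t, Real.exp (-B.r₁ * s))) * hl + (1 - B.a₂) * he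

lemma integral_costMeasure {t : ℝ} (ht : 0 ≤ t) (f : ℝ → ℝ) :
    ∫ s in Ico 0 t, f s ∂B.costMeasure
      = ∫ s in (0 : ℝ)..t, B.z₁ * B.k₂ * (B.γ₁ * Real.exp (-B.γ₁ * s)) * f s := by
  rw [costMeasure, setIntegral_withDensity_eq_setIntegral_toReal_smul (by fun_prop)
    (ae_of_all _ fun _ => ENNReal.ofReal_lt_top) _ measurableSet_Ico,
    integral_Ico_eq_integral_Ioo, ← integral_Ioc_eq_integral_Ioo,
    intervalIntegral.integral_of_le ht]
  refine integral_congr_ae (ae_of_all _ fun s => ?_)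
  simp only
  rw [ENNReal.toReal_ofReal, smul_eq_mul]
  have := B.cost_pos; have := B.γ₁_nonneg
  positivity

lemma integral_gainMeasure (G : StieltjesFunction ℝ) (A : Set ℝ) (f : ℝ → ℝ) :
    ∫ s in A, f s ∂B.gainMeasure G
      = (1 - B.z₁) * (1 - B.w₁ - B.k₂) * ∫ s in A, f s ∂G.measure := by
  rw [gainMeasure, Measure.restrict_smul, integral_smul_measure,
    ENNReal.toReal_ofReal B.gain_pos.le, smul_eq_mul]

/-- The payoff is affine in the probability `1 - q` of resisting, so player 2's response problem
becomes a comparison of two measures on `[0,t)`. -/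
lemma U₂_eq_add (σ₁ : Strategy₁) {t : ℝ} (ht : 0 ≤ t) {q : ℝ → ℝ} (hq : Measurable q)
    (hq' : ∀ s, q s ∈ Icc (0 : ℝ) 1) :
    B.U₂ t q σ₁ = B.U₂ t (fun _ => 1) σ₁
      + B.D * ((∫ s in Ico 0 t, (1 - q s) * Real.exp (-B.r₂ * s) ∂B.gainMeasure σ₁.G)
        - ∫ s in Ico 0 t, (1 - q s) * Real.exp (-B.r₂ * s) ∂B.costMeasure) := by
  have hm : Measurable fun s => 1 - q s := by fun_prop
  have hb := one_sub_mem hq'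
  rw [integral_costMeasure _ ht, integral_gainMeasure]
  have hG : ∫ s in Ico 0 t, (1 - B.a₁ + (1 - q s) * (1 - B.w₁ - B.k₂) * B.D)
        * Real.exp (-B.r₂ * s) ∂σ₁.G.measure
      = (∫ s in Ico 0 t, (1 - B.a₁ + (1 - 1) * (1 - B.w₁ - B.k₂) * B.D)
        * Real.exp (-B.r₂ * s) ∂σ₁.G.measure)
        + (1 - B.w₁ - B.k₂) * B.D * ∫ s in Ico 0 t, (1 - q s) * Real.exp (-B.r₂ * s) ∂σ₁.G.measure
      := by
    have h1 := integrableOn_mul_exp (μ := σ₁.G.measure) hm hb B.r₂ t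
    have h2 := (integrableOn_exp B.r₂ σ₁.G t).mono_set Ico_subset_Icc_self
    rw [← integral_const_mul, ← integral_add]
    · refine integral_congr_ae (ae_of_all _ fun s => ?_)
      ring
    · exact Integrable.const_mul h2 _
    · exact Integrable.const_mul h1 _
  have hH : ∫ s in (0 : ℝ)..t, (1 - B.a₁ - (1 - q s) * B.k₂ * B.D) * Real.exp (-B.r₂ * s)
        * (B.γ₁ * Real.exp (-B.γ₁ * s))
      = (∫ s in (0 : ℝ)..t, (1 - B.a₁ - (1 - 1) * B.k₂ * B.D) * Real.exp (-B.r₂ * s)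
        * (B.γ₁ * Real.exp (-B.γ₁ * s)))
        - B.k₂ * B.D * ∫ s in (0 : ℝ)..t, B.γ₁ * Real.exp (-B.γ₁ * s)
          * ((1 - q s) * Real.exp (-B.r₂ * s)) := by
    have h1 : IntervalIntegrable (fun s => (1 - q s) * Real.exp (-B.r₂ * s)) volume 0 t := by
      rw [intervalIntegrable_iff_integrableOn_Ico_of_le ht]
      exact integrableOn_mul_exp hm hb B.r₂ t
    have h2 : IntervalIntegrable (fun s => B.γ₁ * Real.exp (-B.γ₁ * s)
        * ((1 - q s) * Real.exp (-B.r₂ * s))) volume 0 t := h1.continuousOn_mul (by fun_prop)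
    rw [← intervalIntegral.integral_const_mul, ← intervalIntegral.integral_sub _ (h2.const_mul _)]
    · refine intervalIntegral.integral_congr fun s _ => ?_
      ring
    · exact Continuous.intervalIntegrable (by fun_prop) _ _
  have hc : ∫ s in (0 : ℝ)..t, B.z₁ * B.k₂ * (B.γ₁ * Real.exp (-B.γ₁ * s))
        * ((1 - q s) * Real.exp (-B.r₂ * s))
      = B.z₁ * B.k₂ * ∫ s in (0 : ℝ)..t, B.γ₁ * Real.exp (-B.γ₁ * s)
          * ((1 - q s) * Real.exp (-B.r₂ * s)) := by
    rw [← intervalIntegral.integral_const_mul]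
    exact intervalIntegral.integral_congr fun s _ => by ring
  rw [U₂, U₂, hG, hH, hc]
  ring

lemma intervalIntegrable_challenged (G : StieltjesFunction ℝ) (a b : ℝ) :
    IntervalIntegrable (B.challenged G) volume a b :=
  ((stieltjes_intervalIntegrable G a b).const_mul _).add
    (Continuous.intervalIntegrable (by fun_prop) _ _)

/-- Yielding pays `1 - a₁`, the same as conceding, so challenges matter only because they end the
game and with it the cost of delay; this is the role of `C` in `waitValue`. -/
lemma U₂_one_eq (σ₁ : Strategy₁) {t : ℝ} (ht : 0 ≤ t) :
    B.U₂ t (fun _ => 1) σ₁ = (1 - B.a₁) + B.D * (B.wait₂ σ₁ t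
      - (1 - B.z₁) * Real.exp (-B.r₂ * t) * jump σ₁.F t / 2) := by
  have hD := B.D_pos.ne'
  have hl : B.D * B.rate₂ = B.r₂ * (1 - B.a₁) := by unfold rate₂; field_simp
  have he := integral_exp B.r₂ t
  have hi1 : IntervalIntegrable (fun s => Real.exp (-B.r₂ * s) * σ₁.G s) volume 0 t :=
    intervalIntegrable_exp_mul _ _ _ _
  have hi2 : IntervalIntegrable
      (fun s => Real.exp (-B.r₂ * s) * (1 - Real.exp (-B.γ₁ * s))) volume 0 t :=
    Continuous.intervalIntegrable (by fun_prop) _ _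
  have hC : ∫ s in (0 : ℝ)..t, Real.exp (-B.r₂ * s) * B.challenged σ₁.G s
      = (1 - B.z₁) * (∫ s in (0 : ℝ)..t, Real.exp (-B.r₂ * s) * σ₁.G s)
        + B.z₁ * ∫ s in (0 : ℝ)..t, Real.exp (-B.r₂ * s) * (1 - Real.exp (-B.γ₁ * s)) := by
    rw [← intervalIntegral.integral_const_mul, ← intervalIntegral.integral_const_mul,
      ← intervalIntegral.integral_add (hi1.const_mul _) (hi2.const_mul _)]
    exact intervalIntegral.integral_congr fun s _ => by simp only [challenged]; ring
  have hH : ∫ s in (0 : ℝ)..t, Real.exp (-B.r₂ * s) * (B.γ₁ * Real.exp (-B.γ₁ * s))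
      = Real.exp (-B.r₂ * t) * (1 - Real.exp (-B.γ₁ * t))
        + B.r₂ * ∫ s in (0 : ℝ)..t, Real.exp (-B.r₂ * s) * (1 - Real.exp (-B.γ₁ * s)) := by
    have := intervalIntegral.integral_mul_deriv_eq_deriv_mul (a := 0) (b := t)
      (u := fun s => Real.exp (-B.r₂ * s)) (v := fun s => 1 - Real.exp (-B.γ₁ * s))
      (u' := fun s => -B.r₂ * Real.exp (-B.r₂ * s)) (v' := fun s => B.γ₁ * Real.exp (-B.γ₁ * s))
      (fun x _ => hasDerivAt_exp_mul _ x)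
      (fun x _ => ((hasDerivAt_exp_mul (-B.γ₁) x).const_sub 1).congr_deriv (by ring))
      (Continuous.intervalIntegrable (by fun_prop) _ _)
      (Continuous.intervalIntegrable (by fun_prop) _ _)
    simp only [mul_assoc] at this
    rw [this, intervalIntegral.integral_const_mul]
    simp
  have h1 : ∫ s in (0 : ℝ)..t, (1 - B.a₁ - (1 - 1) * B.k₂ * B.D) * Real.exp (-B.r₂ * s)
        * (B.γ₁ * Real.exp (-B.γ₁ * s))
      = (1 - B.a₁) * ∫ s in (0 : ℝ)..t, Real.exp (-B.r₂ * s)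
        * (B.γ₁ * Real.exp (-B.γ₁ * s)) := by
    rw [← intervalIntegral.integral_const_mul]
    exact intervalIntegral.integral_congr fun s _ => by ring
  rw [U₂, wait₂, waitValue_eq (stieltjes_intervalIntegrable _)
    (B.intervalIntegrable_challenged _), h1, hH, hC, integral_const_mul, integral_const_mul,
    integral_exp_Ico σ₁.F_neg _ ht, integral_exp_Ico σ₁.G_neg _ ht]
  have ha : B.a₂ = B.D + (1 - B.a₁) := by unfold D; ring
  have hj : leftLim σ₁.F t = σ₁.F t - jump σ₁.F t := by unfold jump; ring
  rw [ha, hj]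
  linear_combination (-(1 - B.z₁) * (∫ s in (0 : ℝ)..t, Real.exp (-B.r₂ * s) * σ₁.F s)
    - ((1 - B.z₁) * (∫ s in (0 : ℝ)..t, Real.exp (-B.r₂ * s) * σ₁.G s)
        + B.z₁ * ∫ s in (0 : ℝ)..t, Real.exp (-B.r₂ * s) * (1 - Real.exp (-B.γ₁ * s)))
    + (∫ s in (0 : ℝ)..t, Real.exp (-B.r₂ * s))) * hl + (1 - B.a₁) * he

end UltimatumGame

/-! ### Tools for extracting optimality conditions. -/

lemma measure_le_of_setIntegral_le {μ ν : Measure ℝ} {w : ℝ → ℝ} {S : Set ℝ}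
    (hS : MeasurableSet S) (hw : Measurable w) (h0 : ∀ x, 0 ≤ w x) (hμ : IntegrableOn w S μ)
    (hν : IntegrableOn w S ν)
    (h : ∀ A, MeasurableSet A → A ⊆ S → ∫ x in A, w x ∂μ ≤ ∫ x in A, w x ∂ν) {A : Set ℝ}
    (hA : MeasurableSet A) (hAS : A ⊆ S) (hpos : ∀ x ∈ A, 0 < w x) : μ A ≤ ν A := by
  set f : ℝ → ENNReal := fun x => ENNReal.ofReal (w x) with hf
  have hfm : Measurable f := by fun_prop
  have hle : (μ.restrict S).withDensity f ≤ (ν.restrict S).withDensity f := by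
    refine Measure.le_iff.2 fun E hE => ?_
    rw [withDensity_apply _ hE, withDensity_apply _ hE, Measure.restrict_restrict hE,
      Measure.restrict_restrict hE,
      ← ofReal_integral_eq_lintegral_ofReal (hμ.mono_set inter_subset_right)
        (ae_of_all _ h0),
      ← ofReal_integral_eq_lintegral_ofReal (hν.mono_set inter_subset_right) (ae_of_all _ h0)]
    exact ENNReal.ofReal_le_ofReal (h _ (hE.inter hS) inter_subset_right)
  -- The weighted measures are ordered; dividing by the weight, positive on `A`, recovers the
  -- originals.
  have key : ∀ μ : Measure ℝ, μ A = ∫⁻ x in A, (f x)⁻¹ ∂(μ.restrict S).withDensity f := by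
    intro μ
    rw [setLIntegral_withDensity_eq_setLIntegral_mul _ hfm (by fun_prop) hA]
    have : ∫⁻ x in A, (f * fun x => (f x)⁻¹) x ∂μ.restrict S = ∫⁻ _ in A, 1 ∂μ.restrict S := by
      refine setLIntegral_congr_fun hA fun x hx => ?_
      exact ENNReal.mul_inv_cancel (ENNReal.ofReal_pos.2 (hpos x hx)).ne' ENNReal.ofReal_ne_top
    rw [this, setLIntegral_one, Measure.restrict_apply hA, inter_eq_left.2 hAS]
  rw [key μ, key ν]
  exact lintegral_mono' (Measure.restrict_mono subset_rfl hle) le_rfl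

lemma exists_above_sublevel {F : StieltjesFunction ℝ} (hF : ∀ t < 0, F t = 0)
    (h1 : ∀ t, F t ≤ 1) (hm : F.measure.real univ = 1) {P : ℝ → Prop}
    (hP : ∀ᵐ t ∂F.measure, P t) {c : ℝ} (hc0 : 0 ≤ c) (hc : c < 1) :
    ∃ t, P t ∧ ∀ s, F s ≤ c → s < t := by
  have htop : Tendsto F atTop (𝓝 1) := hm ▸ tendsto_measure_real_univ hF h1
  obtain ⟨b, hb⟩ := (htop.eventually (lt_mem_nhds hc)).exists
  have hne : {s | F s ≤ c}.Nonempty := ⟨-1, by simp [hF (-1) (by norm_num), hc0]⟩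
  have hbdd : BddAbove {s | F s ≤ c} :=
    ⟨b, fun s hs => by
      by_contra! h
      exact absurd (F.mono h.le) (not_le.2 (lt_of_le_of_lt hs hb))⟩
  set x := sSup {s | F s ≤ c}
  have hex : ∀ E : Set ℝ, 0 < F.measure E → ∃ t ∈ E, P t := by
    intro E hE
    by_contra! hcon
    refine hE.ne' (measure_mono_null (fun t ht => hcon t ht) (ae_iff.1 hP))
  -- Some mass lies beyond the sublevel set in either case. If `F x > c`, all of it may be an atom
  -- at `x`, so `x` itself must be allowed.
  rcases le_or_gt (F x) c with hx | hx
  · obtain ⟨t, ht, htP⟩ := hex (Ioi x) (by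
      rw [F.measure_Ioi htop, ENNReal.ofReal_pos]; linarith)
    exact ⟨t, htP, fun s hs => (le_csSup hbdd hs).trans_lt ht⟩
  · have hl : leftLim F x ≤ c := by
      refine le_of_tendsto (F.mono.tendsto_leftLim x) ?_
      filter_upwards [self_mem_nhdsWithin] with s hs
      obtain ⟨u, hu, hsu⟩ := exists_lt_of_lt_csSup hne hs
      exact (F.mono hsu.le).trans hu
    obtain ⟨t, ht, htP⟩ := hex (Ici x) (by
      rw [F.measure_Ici htop, ENNReal.ofReal_pos]; linarith)
    refine ⟨t, htP, fun s hs => lt_of_lt_of_le (lt_of_le_of_ne (le_csSup hbdd hs) ?_) ht⟩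
    rintro rfl
    exact absurd hs (not_le.2 hx)

/-- Conceding just after `t` collects an atom at `t` in full, and the atoms met on the way down to
`t` are squeezed to zero by right-continuity. -/
lemma waitValue_le_of_sub_jump_le {p r l m : ℝ} (hp : 0 ≤ p) (F : StieltjesFunction ℝ)
    {C : ℝ → ℝ} (hC : ∀ a b, IntervalIntegrable C volume a b)
    (h : ∀ t, 0 ≤ t → waitValue p r l F C t - p * Real.exp (-r * t) * jump F t / 2 ≤ m) (t : ℝ)
    (ht : 0 ≤ t) : waitValue p r l F C t ≤ m := by
  have hsub : 𝓝[>] t ≤ 𝓝[≥] t := nhdsWithin_mono _ Ioi_subset_Ici_self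
  have h1 := (waitValue_continuousWithinAt (p := p) (r := r) (l := l) F hC t).tendsto.mono_left hsub
  have h2 := (F.right_continuous t).tendsto.mono_left hsub
  have h3 : Tendsto (fun s => p * Real.exp (-r * s)) (𝓝[>] t) (𝓝 (p * Real.exp (-r * t))) :=
    ((by fun_prop : Continuous fun t => p * Real.exp (-r * t)).tendsto t).mono_left
      nhdsWithin_le_nhds
  have h4 := h1.sub ((h3.mul (h2.sub_const (F t))).div_const 2)
  rw [sub_self, mul_zero, zero_div, sub_zero] at h4
  refine le_of_tendsto h4 ?_
  filter_upwards [self_mem_nhdsWithin] with s hs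
  have h5 : p * Real.exp (-r * s) * jump F s ≤ p * Real.exp (-r * s) * (F s - F t) :=
    mul_le_mul_of_nonneg_left (jump_le hs) (by positivity)
  linarith [h s (ht.trans (le_of_lt hs))]

/-! ### Necessary conditions for equilibrium. -/

namespace UltimatumGame

variable {B : UltimatumGame} {σ₁ : Strategy₁} {σ₂ : Strategy₂}

section OptimalResponse

variable {t : ℝ} {q : ℝ → ℝ}

/-- The deviation is to resist for sure on an arbitrary `E ⊆ [0,t)`; its effect is the integral of
`q` over `E` against gain minus cost. -/
lemma gain_le_cost_of_forall_U₂_le (ht : 0 ≤ t) (hq : Measurable q)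
    (hq' : ∀ s, q s ∈ Icc (0 : ℝ) 1)
    (h : ∀ q', Measurable q' → (∀ s, q' s ∈ Icc (0 : ℝ) 1) → B.U₂ t q' σ₁ ≤ B.U₂ t q σ₁)
    {A : Set ℝ} (hA : MeasurableSet A) (hAt : A ⊆ Ico 0 t) (hpos : ∀ s ∈ A, 0 < q s) :
    B.gainMeasure σ₁.G A ≤ B.costMeasure A := by
  refine measure_le_of_setIntegral_le (w := fun s => q s * Real.exp (-B.r₂ * s))
    measurableSet_Ico (by fun_prop) (fun s => mul_nonneg (hq' s).1 (Real.exp_pos _).le)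
    (integrableOn_mul_exp hq hq' _ t) (integrableOn_mul_exp hq hq' _ t) ?_ hA hAt
    (fun s hs => mul_pos (hpos s hs) (Real.exp_pos _))
  intro E hE hEt
  have hq'' : ∀ s, Eᶜ.indicator q s ∈ Icc (0 : ℝ) 1 := by
    intro s
    by_cases hs : s ∈ E
    · simp [hs]
    · simpa [hs] using hq' s
  have h1 := h _ (hq.indicator hE.compl) hq''
  rw [B.U₂_eq_add σ₁ ht hq hq', B.U₂_eq_add σ₁ ht (hq.indicator hE.compl) hq''] at h1
  have key : ∀ μ : Measure ℝ, IsLocallyFiniteMeasure μ →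
      ∫ s in Ico 0 t, (1 - Eᶜ.indicator q s) * Real.exp (-B.r₂ * s) ∂μ
        = (∫ s in Ico 0 t, (1 - q s) * Real.exp (-B.r₂ * s) ∂μ)
          + ∫ s in E, q s * Real.exp (-B.r₂ * s) ∂μ := by
    intro μ _
    have h2 : ∫ s in E, q s * Real.exp (-B.r₂ * s) ∂μ
        = ∫ s in Ico 0 t, E.indicator (fun s => q s * Real.exp (-B.r₂ * s)) s ∂μ := by
      rw [setIntegral_indicator hE, inter_eq_right.2 hEt]
    rw [h2, ← integral_add (integrableOn_mul_exp (by fun_prop) (one_sub_mem hq') _ t)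
      ((integrableOn_mul_exp hq hq' _ t).indicator hE)]
    refine integral_congr_ae (ae_of_all _ fun s => ?_)
    by_cases hs : s ∈ E
    · simp [hs]; ring
    · simp [hs]
  rw [key _ inferInstance, key _ inferInstance] at h1
  have := B.D_pos
  nlinarith

/-- The mirror image: here the deviation yields for sure on `E`. -/
lemma cost_le_gain_of_forall_U₂_le (ht : 0 ≤ t) (hq : Measurable q)
    (hq' : ∀ s, q s ∈ Icc (0 : ℝ) 1)
    (h : ∀ q', Measurable q' → (∀ s, q' s ∈ Icc (0 : ℝ) 1) → B.U₂ t q' σ₁ ≤ B.U₂ t q σ₁)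
    {A : Set ℝ} (hA : MeasurableSet A) (hAt : A ⊆ Ico 0 t) (hlt : ∀ s ∈ A, q s < 1) :
    B.costMeasure A ≤ B.gainMeasure σ₁.G A := by
  have hm : Measurable fun s => 1 - q s := by fun_prop
  have hb := one_sub_mem hq'
  refine measure_le_of_setIntegral_le (w := fun s => (1 - q s) * Real.exp (-B.r₂ * s))
    measurableSet_Ico (by fun_prop) (fun s => mul_nonneg (hb s).1 (Real.exp_pos _).le)
    (integrableOn_mul_exp hm hb _ t) (integrableOn_mul_exp hm hb _ t) ?_ hA hAt
    (fun s hs => mul_pos (sub_pos.2 (hlt s hs)) (Real.exp_pos _))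
  intro E hE hEt
  classical
  have hm' : Measurable (E.piecewise (fun _ => 1) q) := measurable_const.piecewise hE hq
  have hq'' : ∀ s, E.piecewise (fun _ => 1) q s ∈ Icc (0 : ℝ) 1 := by
    intro s
    by_cases hs : s ∈ E
    · simp [hs]
    · simpa [hs] using hq' s
  have h1 := h _ hm' hq''
  rw [B.U₂_eq_add σ₁ ht hq hq', B.U₂_eq_add σ₁ ht hm' hq''] at h1
  have key : ∀ μ : Measure ℝ, IsLocallyFiniteMeasure μ →
      ∫ s in Ico 0 t, (1 - E.piecewise (fun _ => 1) q s) * Real.exp (-B.r₂ * s) ∂μ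
        = (∫ s in Ico 0 t, (1 - q s) * Real.exp (-B.r₂ * s) ∂μ)
          - ∫ s in E, (1 - q s) * Real.exp (-B.r₂ * s) ∂μ := by
    intro μ _
    have h2 : ∫ s in E, (1 - q s) * Real.exp (-B.r₂ * s) ∂μ
        = ∫ s in Ico 0 t, E.indicator (fun s => (1 - q s) * Real.exp (-B.r₂ * s)) s ∂μ := by
      rw [setIntegral_indicator hE, inter_eq_right.2 hEt]
    rw [h2, ← integral_sub (integrableOn_mul_exp hm hb _ t)
      ((integrableOn_mul_exp hm hb _ t).indicator hE)]
    refine integral_congr_ae (ae_of_all _ fun s => ?_)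
    by_cases hs : s ∈ E <;> simp [hs]
  rw [key _ inferInstance, key _ inferInstance] at h1
  have := B.D_pos
  nlinarith

lemma U₂_le_of_gain_le_cost (hle : B.gainMeasure σ₁.G ≤ B.costMeasure) (ht : 0 ≤ t)
    (hq : Measurable q) (hq' : ∀ s, q s ∈ Icc (0 : ℝ) 1) :
    B.U₂ t q σ₁ ≤ B.U₂ t (fun _ => 1) σ₁ := by
  rw [B.U₂_eq_add σ₁ ht hq hq']
  have hb := one_sub_mem hq'
  have := integral_mono_measure (f := fun s => (1 - q s) * Real.exp (-B.r₂ * s))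
    (Measure.restrict_mono (subset_refl (Ico 0 t)) hle)
    (ae_of_all _ fun s => mul_nonneg (hb s).1 (Real.exp_pos _).le)
    (integrableOn_mul_exp (by fun_prop) hb _ t)
  have := B.D_pos
  nlinarith

end OptimalResponse

lemma one_sub_z₁_pos (B : UltimatumGame) : 0 < 1 - B.z₁ := sub_pos.2 B.z₁_lt_one

lemma one_sub_z₂_pos (B : UltimatumGame) : 0 < 1 - B.z₂ := sub_pos.2 B.z₂_lt_one

lemma survival₂_pos (B : UltimatumGame) (σ₂ : Strategy₂) (t : ℝ) :
    B.z₂ ≤ 1 - (1 - B.z₂) * σ₂.F t := by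
  have := B.one_sub_z₂_pos
  nlinarith [σ₂.F_le t]

lemma survival₁_pos (B : UltimatumGame) (σ₁ : Strategy₁) (t : ℝ) :
    0 < 1 - (1 - B.z₁) * σ₁.F t - B.challenged σ₁.G t := by
  have := B.one_sub_z₁_pos
  have := mul_pos B.z₁_pos (Real.exp_pos (-B.γ₁ * t))
  unfold challenged
  nlinarith [σ₁.F_add_G_le t]

namespace IsEquilibrium

lemma U₁_le (h : B.IsEquilibrium σ₁ σ₂) {t : ℝ} (ht : 0 ≤ t) : B.U₁ t σ₂ ≤ B.u₁ σ₁ σ₂ := by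
  have := h.1 (Strategy₁.concedeAt t ht)
  rw [u₁, Strategy₁.concedeAt, integral_cdf_dirac ht, StieltjesFunction.measure_zero] at this
  simpa using this

lemma V₁_le (h : B.IsEquilibrium σ₁ σ₂) {t : ℝ} (ht : 0 ≤ t) : B.V₁ t σ₂ ≤ B.u₁ σ₁ σ₂ := by
  have := h.1 (Strategy₁.challengeAt t ht)
  rw [u₁, Strategy₁.challengeAt, integral_cdf_dirac ht, StieltjesFunction.measure_zero] at this
  simpa using this

lemma U₂_le (h : B.IsEquilibrium σ₁ σ₂) {t : ℝ} (ht : 0 ≤ t) {q : ℝ → ℝ} (hq : Measurable q)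
    (hq' : ∀ s, q s ∈ Icc (0 : ℝ) 1) : B.U₂ t q σ₁ ≤ B.u₂ σ₂ σ₁ := by
  have := h.2 (Strategy₂.concedeAt t ht q hq hq')
  rwa [u₂, Strategy₂.concedeAt, integral_cdf_dirac ht] at this

lemma U₂_one_le (h : B.IsEquilibrium σ₁ σ₂) {t : ℝ} (ht : 0 ≤ t) :
    B.U₂ t (fun _ => 1) σ₁ ≤ B.u₂ σ₂ σ₁ :=
  h.U₂_le ht measurable_const fun _ => ⟨zero_le_one, le_rfl⟩

/-- Mass that never acts earns `0`, so positivity is what forces the strategies to have full mass in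
`ae₁`. -/
lemma u₁_pos (h : B.IsEquilibrium σ₁ σ₂) : 0 < B.u₁ σ₁ σ₂ := by
  refine lt_of_lt_of_le ?_ (h.U₁_le le_rfl)
  rw [B.U₁_eq σ₂ le_rfl, wait₁, waitValue_zero, jump_zero σ₂.F_neg]
  have h1 := B.a₂_lt_one
  have h2 : 0 ≤ B.D * ((1 - B.z₂) * σ₂.F 0) :=
    mul_nonneg B.D_pos.le (mul_nonneg B.one_sub_z₂_pos.le (stieltjes_nonneg σ₂.F_neg 0))
  simp only [mul_zero, Real.exp_zero]
  linarith

lemma u₂_pos (h : B.IsEquilibrium σ₁ σ₂) : 0 < B.u₂ σ₂ σ₁ := by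
  refine lt_of_lt_of_le ?_ (h.U₂_one_le le_rfl)
  rw [B.U₂_one_eq σ₁ le_rfl, wait₂, waitValue_zero, jump_zero σ₁.F_neg]
  have h1 := B.a₁_lt_one
  have h2 : 0 ≤ B.D * ((1 - B.z₁) * σ₁.F 0) :=
    mul_nonneg B.D_pos.le (mul_nonneg B.one_sub_z₁_pos.le (stieltjes_nonneg σ₁.F_neg 0))
  simp only [mul_zero, Real.exp_zero]
  linarith

lemma ae₁ (h : B.IsEquilibrium σ₁ σ₂) : σ₁.F.measure.real univ + σ₁.G.measure.real univ = 1 ∧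
    (∀ᵐ t ∂σ₁.F.measure, B.U₁ t σ₂ = B.u₁ σ₁ σ₂) ∧
      ∀ᵐ t ∂σ₁.G.measure, B.V₁ t σ₂ = B.u₁ σ₁ σ₂ := by
  refine ae_eq_of_integral_add_eq h.u₁_pos
    ((ae_nonneg_of_neg σ₁.F_neg).mono fun t ht => h.U₁_le ht)
    ((ae_nonneg_of_neg σ₁.G_neg).mono fun t ht => h.V₁_le ht) σ₁.measure_add_le ?_
  rw [u₁, restrict_Ici_of_neg σ₁.F_neg, restrict_Ici_of_neg σ₁.G_neg]

lemma ae₂ (h : B.IsEquilibrium σ₁ σ₂) : σ₂.F.measure.real univ = 1 ∧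
    ∀ᵐ t ∂σ₂.F.measure, B.U₂ t σ₂.q σ₁ = B.u₂ σ₂ σ₁ := by
  have := ae_eq_of_integral_add_eq (μ := σ₂.F.measure) (ν := (0 : Measure ℝ))
    (U := fun t => B.U₂ t σ₂.q σ₁) (V := fun _ => 0) h.u₂_pos
    ((ae_nonneg_of_neg σ₂.F_neg).mono fun t ht => h.U₂_le ht σ₂.q_measurable σ₂.q_mem)
    (by simp) (by simpa using σ₂.measure_le)
    (by rw [u₂, restrict_Ici_of_neg σ₂.F_neg]; simp)
  exact ⟨by simpa using this.1, this.2.1⟩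

/-- Player 1's normalized equilibrium payoff. -/
def value₁ (B : UltimatumGame) (σ₁ : Strategy₁) (σ₂ : Strategy₂) : ℝ :=
  (B.u₁ σ₁ σ₂ - (1 - B.a₂)) / B.D

/-- Player 2's normalized equilibrium payoff. -/
def value₂ (B : UltimatumGame) (σ₁ : Strategy₁) (σ₂ : Strategy₂) : ℝ :=
  (B.u₂ σ₂ σ₁ - (1 - B.a₁)) / B.D

lemma wait₁_le (h : B.IsEquilibrium σ₁ σ₂) (t : ℝ) (ht : 0 ≤ t) :
    B.wait₁ σ₂ t ≤ value₁ B σ₁ σ₂ := by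
  refine waitValue_le_of_sub_jump_le B.one_sub_z₂_pos.le _ (fun _ _ => by simp)
    (fun t ht => ?_) t ht
  have h1 := h.U₁_le ht
  rw [B.U₁_eq σ₂ ht, wait₁] at h1
  rw [value₁, le_div_iff₀ B.D_pos]
  linarith

lemma wait₂_le (h : B.IsEquilibrium σ₁ σ₂) (t : ℝ) (ht : 0 ≤ t) :
    B.wait₂ σ₁ t ≤ value₂ B σ₁ σ₂ := by
  refine waitValue_le_of_sub_jump_le B.one_sub_z₁_pos.le _ (B.intervalIntegrable_challenged _)
    (fun t ht => ?_) t ht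
  have h1 := h.U₂_one_le ht
  rw [B.U₂_one_eq σ₁ ht, wait₂] at h1
  rw [value₂, le_div_iff₀ B.D_pos]
  linarith

lemma wait₁_add_le (h : B.IsEquilibrium σ₁ σ₂) {t : ℝ} (ht : 0 ≤ t) :
    B.wait₁ σ₂ t + B.challengeGain (σ₂.F t) (σ₂.q t) t ≤ value₁ B σ₁ σ₂ := by
  have h1 := h.V₁_le ht
  rw [B.V₁_eq σ₂ ht] at h1
  rw [value₁, le_div_iff₀ B.D_pos]
  linarith

lemma ae_wait₁_add_eq (h : B.IsEquilibrium σ₁ σ₂) : ∀ᵐ t ∂σ₁.G.measure,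
    B.wait₁ σ₂ t + B.challengeGain (σ₂.F t) (σ₂.q t) t = value₁ B σ₁ σ₂ := by
  filter_upwards [h.ae₁.2.2, ae_nonneg_of_neg σ₁.G_neg] with t h1 ht
  rw [B.V₁_eq σ₂ ht] at h1
  rw [value₁, eq_div_iff B.D_pos.ne']
  linarith

/-- Player 1 challenges only as long as player 2 may still be unjustified and may yield. -/
lemma ae_challenge (h : B.IsEquilibrium σ₁ σ₂) : ∀ᵐ t ∂σ₁.G.measure,
    0 < σ₂.q t ∧ B.z₂ ≤ (1 - B.c₁) * (1 - (1 - B.z₂) * σ₂.F t) := by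
  filter_upwards [h.ae_wait₁_add_eq, ae_nonneg_of_neg σ₁.G_neg] with t h1 ht
  have h2 := h.wait₁_le t ht
  have h3 : 0 ≤ B.challengeGain (σ₂.F t) (σ₂.q t) t := by linarith
  rw [challengeGain, mul_nonneg_iff_of_pos_left (Real.exp_pos _)] at h3
  have hS := B.survival₂_pos σ₂ t
  have hz := B.z₂_pos
  have hw := B.w₁_nonneg
  have hwc := B.w₁_lt_c₁
  have hc := B.c₁_lt_one
  obtain ⟨hq0, hq1⟩ := σ₂.q_mem t
  have hE : (1 - B.z₂) * (1 - σ₂.F t) = 1 - (1 - B.z₂) * σ₂.F t - B.z₂ := by ring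
  rw [hE] at h3
  set S := 1 - (1 - B.z₂) * σ₂.F t
  constructor
  -- Against sure resistance a challenge wins with probability at most `w₁ < c₁`, so its gain is
  -- negative.
  · by_contra! hq
    have : σ₂.q t = 0 := le_antisymm hq hq0
    rw [this] at h3
    nlinarith
  · have : (S - B.z₂) * (B.w₁ + σ₂.q t * (1 - B.w₁)) ≤ (S - B.z₂) * 1 := by
      apply mul_le_mul_of_nonneg_left _ (by linarith)
      nlinarith
    nlinarith

lemma ae_nonneg_forall_U₂_le (h : B.IsEquilibrium σ₁ σ₂) : ∀ᵐ t ∂σ₂.F.measure, 0 ≤ t ∧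
    ∀ q', Measurable q' → (∀ s, q' s ∈ Icc (0 : ℝ) 1) → B.U₂ t q' σ₁ ≤ B.U₂ t σ₂.q σ₁ := by
  filter_upwards [h.ae₂.2, ae_nonneg_of_neg σ₂.F_neg] with t h1 ht
  exact ⟨ht, fun q' hq hq' => h1 ▸ h.U₂_le ht hq hq'⟩

/-- Bluffs occur only where `q₂ > 0` and `F₂` is bounded away from 1. As `F₂` has mass 1, some
optimal concession time `t` lies beyond all of these, and optimality of `q₂` for that `t` gives the
bound. -/
lemma gain_le_cost (h : B.IsEquilibrium σ₁ σ₂) :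
    B.gainMeasure σ₁.G ≤ B.costMeasure := by
  have hz := B.one_sub_z₂_pos
  have hc : 0 < 1 - B.c₁ := sub_pos.2 B.c₁_lt_one
  -- The bound of `ae_challenge` solved for `F₂`, truncated at `0` because the formula may be
  -- negative.
  set c : ℝ := max 0 ((1 - B.z₂ / (1 - B.c₁)) / (1 - B.z₂)) with hcdef
  have hc1 : c < 1 := by
    refine max_lt one_pos ?_
    rw [div_lt_one hz]
    have : B.z₂ < B.z₂ / (1 - B.c₁) := by
      rw [lt_div_iff₀ hc]
      nlinarith [B.z₂_pos, B.w₁_nonneg, B.w₁_lt_c₁]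
    linarith
  obtain ⟨t, ⟨ht, hopt⟩, hs⟩ := exists_above_sublevel σ₂.F_neg σ₂.F_le h.ae₂.1
    h.ae_nonneg_forall_U₂_le (le_max_left _ _) hc1
  set E : Set ℝ := {s | 0 < σ₂.q s} ∩ {s | σ₂.F s ≤ c} ∩ Ici 0 with hE
  have hEm : MeasurableSet E :=
    ((measurableSet_lt measurable_const σ₂.q_measurable).inter
      (measurableSet_le (measurable_stieltjes _) measurable_const)).inter measurableSet_Ici
  have hEae : ∀ᵐ s ∂B.gainMeasure σ₁.G, s ∈ E := by
    refine Measure.ae_smul_measure ?_ _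
    filter_upwards [h.ae_challenge, ae_nonneg_of_neg σ₁.G_neg] with s h1 h0
    refine ⟨⟨h1.1, show σ₂.F s ≤ c from le_trans ?_ (le_max_right _ _)⟩, h0⟩
    rw [le_div_iff₀ hz]
    have : B.z₂ / (1 - B.c₁) ≤ 1 - (1 - B.z₂) * σ₂.F s := by
      rw [div_le_iff₀ hc]; linarith [h1.2]
    linarith
  refine Measure.le_iff.2 fun A hA => ?_
  have h1 : B.gainMeasure σ₁.G A = B.gainMeasure σ₁.G (A ∩ E) :=
    measure_congr (by
      filter_upwards [hEae] with s hs
      exact propext ⟨fun hA => ⟨hA, hs⟩, fun hA => hA.1⟩)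
  rw [h1]
  refine le_trans ?_ (measure_mono (inter_subset_left (t := E)))
  exact gain_le_cost_of_forall_U₂_le ht σ₂.q_measurable σ₂.q_mem hopt (hA.inter hEm)
    (fun s hs' => ⟨hs'.2.2, hs s hs'.2.1.2⟩) (fun s hs' => hs'.2.1.1)

/-- Where player 1 concedes, the payoff with half the jump subtracted attains the bound that `wait₁`
also satisfies, so the jump is zero. -/
lemma warSide₁ (h : B.IsEquilibrium σ₁ σ₂) :
    WarSide σ₂.F σ₁.F (B.wait₁ σ₂) (value₁ B σ₁ σ₂) where
  right_cont t _ := waitValue_continuousWithinAt _ (fun _ _ => by simp) t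
  lt_of_const s t hs hst heq := by
    refine waitValue_lt_of_const (stieltjes_intervalIntegrable _) (fun _ _ => by simp)
      B.rate₁_pos hst (fun u hu => le_antisymm (heq ▸ σ₂.F.mono hu.2) (σ₂.F.mono hu.1))
      (fun u _ => ?_)
    linarith [B.survival₂_pos σ₂ u, B.z₂_pos]
  le := h.wait₁_le
  ae := by
    filter_upwards [h.ae₁.2.1, ae_nonneg_of_neg σ₁.F_neg] with t h1 ht
    have h2 := h.wait₁_le t ht
    rw [B.U₁_eq σ₂ ht] at h1
    rw [value₁, le_div_iff₀ B.D_pos] at h2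
    rw [value₁, eq_div_iff B.D_pos.ne']
    have h3 := jump_nonneg σ₂.F t
    have h4 : 0 < B.D * ((1 - B.z₂) * Real.exp (-B.r₁ * t)) :=
      mul_pos B.D_pos (mul_pos B.one_sub_z₂_pos (Real.exp_pos _))
    have h5 : jump σ₂.F t = 0 := by nlinarith
    rw [h5] at h1
    exact ⟨by linarith, h5⟩

/-- By `gain_le_cost`, always yielding does at least as well as `q₂`, so `wait₂`, defined for a
player who yields, governs the concessions. -/
lemma warSide₂ (h : B.IsEquilibrium σ₁ σ₂) :
    WarSide σ₁.F σ₂.F (B.wait₂ σ₁) (value₂ B σ₁ σ₂) where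
  right_cont t _ := waitValue_continuousWithinAt _ (B.intervalIntegrable_challenged _) t
  lt_of_const s t hs hst heq :=
    waitValue_lt_of_const (stieltjes_intervalIntegrable _) (B.intervalIntegrable_challenged _)
      B.rate₂_pos hst (fun u hu => le_antisymm (heq ▸ σ₁.F.mono hu.2) (σ₁.F.mono hu.1))
      (fun u _ => B.survival₁_pos σ₁ u)
  le := h.wait₂_le
  ae := by
    filter_upwards [h.ae₂.2, ae_nonneg_of_neg σ₂.F_neg] with t h1 ht
    have h2 := h.wait₂_le t ht
    have h1' := U₂_le_of_gain_le_cost h.gain_le_cost ht σ₂.q_measurable σ₂.q_mem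
    rw [h1, B.U₂_one_eq σ₁ ht] at h1'
    rw [value₂, le_div_iff₀ B.D_pos] at h2
    rw [value₂, eq_div_iff B.D_pos.ne']
    have h3 := jump_nonneg σ₁.F t
    have h4 : 0 < B.D * ((1 - B.z₁) * Real.exp (-B.r₂ * t)) :=
      mul_pos B.D_pos (mul_pos B.one_sub_z₁_pos (Real.exp_pos _))
    have h5 : jump σ₁.F t = 0 := by nlinarith
    rw [h5] at h1'
    exact ⟨by linarith, h5⟩

end IsEquilibrium

end UltimatumGame

/-! ### The explicit paths ending at a given time `T`. -/

lemma hasDerivWithinAt_comp_min {f : ℝ → ℝ} {f' a t : ℝ} (hf : HasDerivAt f f' t) :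
    HasDerivWithinAt (fun s => f (min s a)) (if t < a then f' else 0) (Ici t) t := by
  split_ifs with h
  · refine hf.hasDerivWithinAt.congr_of_eventuallyEq ?_ (by rw [min_eq_left h.le])
    filter_upwards [mem_nhdsWithin_of_mem_nhds (Iio_mem_nhds h)] with s hs
    rw [min_eq_left (le_of_lt hs)]
  · refine (hasDerivWithinAt_const t (Ici t) (f a)).congr (fun s hs => ?_) ?_
    · rw [min_eq_right ((not_lt.1 h).trans hs)]
    · rw [min_eq_right (not_lt.1 h)]

namespace UltimatumGame

variable (B : UltimatumGame)

/-- The time until which player 1 challenges if the players concede until `T`. -/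
def cutoff (T : ℝ) : ℝ := max 0 (T + Real.log (1 - B.c₁) / B.rate₁)

/-- The number of challenges of the unjustified player 1, per challenge of the justified one, that
makes player 2 indifferent. -/
def bluffRatio : ℝ := B.k₂ / (1 - B.w₁ - B.k₂)

/-- The integral of `exp ((rate₂ - γ₁) s)` over `[0,t]`. -/
def expInt (t : ℝ) : ℝ := ∫ s in (0 : ℝ)..t, Real.exp ((B.rate₂ - B.γ₁) * s)

/-- The total probability that player 2 has not conceded by time `t`, if her concessions end
at `T`. -/
def remain₂ (T t : ℝ) : ℝ := B.z₂ * Real.exp (B.rate₁ * (T - t))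

/-- Player 2's concessions if they end at `T`. -/
def path₂ (T t : ℝ) : ℝ := (1 - B.remain₂ T t) / (1 - B.z₂)

/-- Player 1's challenges if concessions end at `T`. -/
def pathG (T t : ℝ) : ℝ :=
  B.bluffRatio * B.z₁ / (1 - B.z₁) * (1 - Real.exp (-B.γ₁ * min t (B.cutoff T)))

/-- The total probability that player 1 has neither conceded nor challenged by time `t`, if
concessions end at `T`. -/
def remain₁ (T t : ℝ) : ℝ :=
  B.z₁ * Real.exp (-B.rate₂ * t) * (Real.exp ((B.rate₂ - B.γ₁) * T)
    + B.γ₁ * (B.expInt T - B.expInt t)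
    + B.bluffRatio * B.γ₁ * (B.expInt (B.cutoff T) - B.expInt (min t (B.cutoff T))))

/-- Player 1's concessions if they end at `T`. -/
def path₁ (T t : ℝ) : ℝ :=
  (1 - B.remain₁ T t - B.challenged (B.pathG T) t) / (1 - B.z₁)

lemma bluffRatio_pos : 0 < B.bluffRatio := div_pos B.k₂_pos (by linarith [B.k₂_lt])

lemma cutoff_nonneg (T : ℝ) : 0 ≤ B.cutoff T := le_max_left _ _

lemma log_div_neg : Real.log (1 - B.c₁) / B.rate₁ < 0 :=
  div_neg_of_neg_of_pos (Real.log_neg (by linarith [B.c₁_lt_one])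
    (by linarith [B.w₁_nonneg, B.w₁_lt_c₁])) B.rate₁_pos

lemma cutoff_lt {T : ℝ} (hT : 0 < T) : B.cutoff T < T :=
  max_lt hT (by linarith [B.log_div_neg])

lemma cutoff_le {T : ℝ} (hT : 0 ≤ T) : B.cutoff T ≤ T :=
  max_le hT (by linarith [B.log_div_neg])

lemma hasDerivAt_expInt (t : ℝ) :
    HasDerivAt B.expInt (Real.exp ((B.rate₂ - B.γ₁) * t)) t := by
  have hc : Continuous fun s => Real.exp ((B.rate₂ - B.γ₁) * s) := by fun_prop
  exact intervalIntegral.integral_hasDerivAt_right (hc.intervalIntegrable 0 t)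
    (hc.stronglyMeasurableAtFilter _ _) hc.continuousAt

lemma continuous_expInt : Continuous B.expInt :=
  continuous_iff_continuousAt.2 fun t => (B.hasDerivAt_expInt t).continuousAt

lemma strictMono_expInt : StrictMono B.expInt :=
  strictMono_of_deriv_pos fun t => by rw [(B.hasDerivAt_expInt t).deriv]; exact Real.exp_pos _

lemma expInt_zero : B.expInt 0 = 0 := by simp [expInt]

lemma exp_eq_expInt (T : ℝ) :
    Real.exp ((B.rate₂ - B.γ₁) * T) = 1 + (B.rate₂ - B.γ₁) * B.expInt T := by
  have h := intervalIntegral.integral_eq_sub_of_hasDerivAt (a := 0) (b := T)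
    (fun x _ => hasDerivAt_exp_mul (B.rate₂ - B.γ₁) x)
    (Continuous.intervalIntegrable (by fun_prop) _ _)
  rw [intervalIntegral.integral_const_mul] at h
  simp only [mul_zero, Real.exp_zero] at h
  rw [expInt]
  linarith

lemma continuous_remain₁ (T : ℝ) : Continuous (B.remain₁ T) := by
  have := B.continuous_expInt
  unfold remain₁
  fun_prop

lemma continuous_pathG (T : ℝ) : Continuous (B.pathG T) := by
  unfold pathG
  fun_prop

lemma continuous_challenged_pathG (T : ℝ) : Continuous (B.challenged (B.pathG T)) := by
  have := B.continuous_pathG T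
  unfold challenged
  fun_prop

lemma continuous_path₁ (T : ℝ) : Continuous (B.path₁ T) := by
  have := B.continuous_remain₁ T
  have := B.continuous_challenged_pathG T
  unfold path₁
  fun_prop

lemma continuous_path₂ (T : ℝ) : Continuous (B.path₂ T) := by
  unfold path₂ remain₂
  fun_prop

lemma one_sub_mul_path₂ (T t : ℝ) : 1 - (1 - B.z₂) * B.path₂ T t = B.remain₂ T t := by
  rw [path₂, mul_div_cancel₀ _ B.one_sub_z₂_pos.ne']
  ring

lemma one_sub_mul_path₁ (T t : ℝ) :
    1 - (1 - B.z₁) * B.path₁ T t - B.challenged (B.pathG T) t = B.remain₁ T t := by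
  rw [path₁, mul_div_cancel₀ _ B.one_sub_z₁_pos.ne']
  ring

lemma hasDerivAt_path₂ (T t : ℝ) :
    HasDerivAt (fun s => (1 - B.z₂) * B.path₂ T s) (B.rate₁ * B.remain₂ T t) t := by
  have h1 : (fun s => (1 - B.z₂) * B.path₂ T s)
      = fun s => 1 - B.z₂ * Real.exp (B.rate₁ * T) * Real.exp (-B.rate₁ * s) := by
    ext s
    have := B.one_sub_mul_path₂ T s
    rw [remain₂, show B.rate₁ * (T - s) = B.rate₁ * T + -B.rate₁ * s by ring, Real.exp_add] at this
    linarith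
  rw [h1, remain₂, show B.rate₁ * (T - t) = B.rate₁ * T + -B.rate₁ * t by ring, Real.exp_add]
  exact (((hasDerivAt_exp_mul (-B.rate₁) t).const_mul _).const_sub 1).congr_deriv (by ring)

lemma waitValue_path₂ (T : ℝ) {t : ℝ} (ht : 0 ≤ t) :
    waitValue (1 - B.z₂) B.r₁ B.rate₁ (B.path₂ T) (fun _ => 0) t
      = (1 - B.z₂) * B.path₂ T 0 := by
  refine waitValue_eq_of_hasDerivWithinAt (T := t) (B.continuous_path₂ T) continuous_const
    (fun s _ => ?_) t ⟨ht, le_rfl⟩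
  rw [sub_zero, one_sub_mul_path₂]
  exact (B.hasDerivAt_path₂ T s).hasDerivWithinAt

/-- `remain₁` is the variation-of-constants solution of `R' = -rate₂ * R - (challenge rate)` with
`R(T) = z₁ exp (-γ₁ T)`. Bluffing stops abruptly at the cutoff, hence the right derivatives. -/
lemma hasDerivWithinAt_path₁ (T t : ℝ) :
    HasDerivWithinAt (fun s => (1 - B.z₁) * B.path₁ T s) (B.rate₂ * B.remain₁ T t) (Ici t) t := by
  have h1 : (fun s => (1 - B.z₁) * B.path₁ T s)
      = fun s => 1 - B.remain₁ T s - B.challenged (B.pathG T) s := by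
    ext s
    have := B.one_sub_mul_path₁ T s
    linarith
  rw [h1]
  -- The factor `χ` treats both sides of the cutoff in a single computation.
  set χ : ℝ := if t < B.cutoff T then 1 else 0 with hχ
  have hE := hasDerivWithinAt_comp_min (a := B.cutoff T) (B.hasDerivAt_expInt t)
  have hG := hasDerivWithinAt_comp_min (a := B.cutoff T) (hasDerivAt_exp_mul (-B.γ₁) t)
  have e1 : (if t < B.cutoff T then Real.exp ((B.rate₂ - B.γ₁) * t) else 0)
      = χ * Real.exp ((B.rate₂ - B.γ₁) * t) := by rw [hχ]; split_ifs <;> simp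
  have e2 : (if t < B.cutoff T then -B.γ₁ * Real.exp (-B.γ₁ * t) else 0)
      = χ * (-B.γ₁ * Real.exp (-B.γ₁ * t)) := by rw [hχ]; split_ifs <;> simp
  rw [e1] at hE
  rw [e2] at hG
  have hexp := (hasDerivAt_exp_mul (-B.rate₂) t).hasDerivWithinAt (s := Ici t)
  have hγ := (hasDerivAt_exp_mul (-B.γ₁) t).hasDerivWithinAt (s := Ici t)
  have hEt := (B.hasDerivAt_expInt t).hasDerivWithinAt (s := Ici t)
  have hR := (hexp.const_mul B.z₁).mul
    ((((hEt.const_sub (B.expInt T)).const_mul B.γ₁).const_add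
      (Real.exp ((B.rate₂ - B.γ₁) * T))).add
      ((hE.const_sub (B.expInt (B.cutoff T))).const_mul (B.bluffRatio * B.γ₁)))
  have hC := (((hG.const_sub 1).const_mul (B.bluffRatio * B.z₁ / (1 - B.z₁))).const_mul
    (1 - B.z₁)).add ((hγ.const_sub 1).const_mul B.z₁)
  refine ((hR.const_sub 1).sub hC).congr_deriv ?_
  have hz := B.one_sub_z₁_pos.ne'
  have hmul : Real.exp (-B.γ₁ * t)
      = Real.exp (-B.rate₂ * t) * Real.exp ((B.rate₂ - B.γ₁) * t) := by
    rw [← Real.exp_add]; congr 1; ring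
  simp only [Pi.add_apply, remain₁]
  rw [hmul]
  field_simp
  ring

lemma waitValue_path₁ (T : ℝ) {t : ℝ} (ht : 0 ≤ t) :
    waitValue (1 - B.z₁) B.r₂ B.rate₂ (B.path₁ T) (B.challenged (B.pathG T)) t
      = (1 - B.z₁) * B.path₁ T 0 := by
  refine waitValue_eq_of_hasDerivWithinAt (T := t) (B.continuous_path₁ T)
    (B.continuous_challenged_pathG T) (fun s _ => ?_) t ⟨ht, le_rfl⟩
  rw [one_sub_mul_path₁]
  exact B.hasDerivWithinAt_path₁ T s

lemma remain₂_self (T : ℝ) : B.remain₂ T T = B.z₂ := by simp [remain₂]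

lemma path₂_self (T : ℝ) : B.path₂ T T = 1 := by
  rw [path₂, remain₂_self, div_self B.one_sub_z₂_pos.ne']

lemma path₁_add_pathG {T : ℝ} (hT : 0 ≤ T) : B.path₁ T T + B.pathG T (B.cutoff T) = 1 := by
  have h1 : B.pathG T T = B.pathG T (B.cutoff T) := by
    simp [pathG, min_eq_right (B.cutoff_le hT)]
  have h2 : B.remain₁ T T = B.z₁ * Real.exp (-B.γ₁ * T) := by
    rw [remain₁, min_eq_right (B.cutoff_le hT), sub_self, sub_self, mul_zero, mul_zero, add_zero,
      add_zero, mul_assoc, ← Real.exp_add]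
    congr 2
    ring
  rw [path₁, challenged, h2, ← h1]
  field_simp [B.one_sub_z₁_pos.ne']
  ring

lemma remain₁_zero (T : ℝ) : B.remain₁ T 0
    = B.z₁ * (1 + B.rate₂ * B.expInt T + B.bluffRatio * B.γ₁ * B.expInt (B.cutoff T)) := by
  rw [remain₁, exp_eq_expInt, expInt_zero, min_eq_left (B.cutoff_nonneg T), expInt_zero]
  simp only [mul_zero, Real.exp_zero]
  ring

lemma remain₁_pos {T t : ℝ} (ht : t ≤ T) : 0 < B.remain₁ T t := by
  have h1 : B.expInt t ≤ B.expInt T := B.strictMono_expInt.monotone ht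
  have h2 : B.expInt (min t (B.cutoff T)) ≤ B.expInt (B.cutoff T) :=
    B.strictMono_expInt.monotone (min_le_right _ _)
  have h3 := B.γ₁_nonneg
  have h4 := B.bluffRatio_pos
  have h5 := B.z₁_pos
  have h6 := sub_nonneg.2 h1
  have h7 := sub_nonneg.2 h2
  unfold remain₁
  positivity

/-- The larger of the total probabilities that a player does not concede at time zero, if
concessions end at `T`. -/
def level (T : ℝ) : ℝ := max (B.remain₁ T 0) (B.remain₂ T 0)

lemma cutoff_mono : Monotone B.cutoff := fun _ _ h => max_le_max le_rfl (by linarith)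

/-- A later end leaves both players with more probability still in the game at time zero; this makes
the exit time unique. -/
lemma strictMono_level : StrictMono B.level := by
  intro S T hST
  refine max_lt_max ?_ ?_
  · rw [remain₁_zero, remain₁_zero]
    have h1 := B.strictMono_expInt hST
    have h2 := B.strictMono_expInt.monotone (B.cutoff_mono hST.le)
    have h3 := mul_lt_mul_of_pos_left h1 B.rate₂_pos
    have h4 := mul_le_mul_of_nonneg_left h2 (mul_nonneg B.bluffRatio_pos.le B.γ₁_nonneg)
    exact mul_lt_mul_of_pos_left (by linarith) B.z₁_pos
  · refine mul_lt_mul_of_pos_left (Real.exp_lt_exp.2 ?_) B.z₂_pos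
    exact mul_lt_mul_of_pos_left (by linarith) B.rate₁_pos

lemma continuous_level : Continuous B.level := by
  have h1 : Continuous fun T => B.remain₁ T 0 := by
    simp_rw [remain₁_zero]
    have := B.continuous_expInt
    unfold cutoff
    fun_prop
  have h2 : Continuous fun T => B.remain₂ T 0 := by unfold remain₂; fun_prop
  exact h1.max h2

lemma level_zero_lt : B.level 0 < 1 := by
  refine max_lt ?_ ?_
  · rw [remain₁_zero, (le_antisymm (B.cutoff_le le_rfl) (B.cutoff_nonneg 0)), expInt_zero]
    simpa using B.z₁_lt_one
  · simpa [remain₂] using B.z₂_lt_one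

lemma exists_level_eq_one : ∃ T, 0 < T ∧ B.level T = 1 := by
  -- The time for which `remain₂ K 0 = 1`, so that `level K ≥ 1`.
  set K := -Real.log B.z₂ / B.rate₁
  have hK : 0 ≤ K :=
    div_nonneg (neg_nonneg.2 (Real.log_nonpos B.z₂_pos.le B.z₂_lt_one.le)) B.rate₁_pos.le
  have h1 : 1 ≤ B.level K := by
    refine le_trans ?_ (le_max_right _ _)
    rw [remain₂, sub_zero, mul_div_cancel₀ _ B.rate₁_pos.ne', Real.exp_neg,
      Real.exp_log B.z₂_pos, mul_inv_cancel₀ B.z₂_pos.ne']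
  obtain ⟨T, hT, hT'⟩ := intermediate_value_Icc hK B.continuous_level.continuousOn
    ⟨B.level_zero_lt.le, h1⟩
  refine ⟨T, lt_of_le_of_ne hT.1 ?_, hT'⟩
  rintro rfl
  exact B.level_zero_lt.ne hT'

/-- The probability of yielding that makes player 1 indifferent between conceding and
challenging. -/
def yieldProb (T t : ℝ) : ℝ :=
  (B.c₁ * B.remain₂ T t / (B.remain₂ T t - B.z₂) - B.w₁) / (1 - B.w₁)

lemma c₁_pos : 0 < B.c₁ := B.w₁_nonneg.trans_lt B.w₁_lt_c₁

lemma w₁_lt_one : B.w₁ < 1 := B.w₁_lt_c₁.trans B.c₁_lt_one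

lemma lt_remain₂ {T t : ℝ} (ht : t < T) : B.z₂ < B.remain₂ T t := by
  refine lt_mul_of_one_lt_right B.z₂_pos (Real.one_lt_exp_iff.2 ?_)
  exact mul_pos B.rate₁_pos (sub_pos.2 ht)

lemma challengeGain_path₂ {T t : ℝ} (ht : t < T) (q : ℝ) :
    B.challengeGain (B.path₂ T t) q t = Real.exp (-B.r₁ * t)
      * ((B.remain₂ T t - B.z₂) * (1 - B.w₁)) * (q - B.yieldProb T t) := by
  have h1 := B.one_sub_mul_path₂ T t
  have h2 : (1 - B.z₂) * (1 - B.path₂ T t) = B.remain₂ T t - B.z₂ := by linarith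
  have h3 : B.remain₂ T t - B.z₂ ≠ 0 := (sub_pos.2 (B.lt_remain₂ ht)).ne'
  have h4 : 1 - B.w₁ ≠ 0 := (sub_pos.2 B.w₁_lt_one).ne'
  rw [challengeGain, h1, h2, yieldProb]
  field_simp
  ring

lemma challengeGain_nonneg_iff {T t : ℝ} (ht : t < T) (q : ℝ) :
    0 ≤ B.challengeGain (B.path₂ T t) q t ↔ B.yieldProb T t ≤ q := by
  rw [challengeGain_path₂ _ ht, mul_nonneg_iff_of_pos_left, sub_nonneg]
  exact mul_pos (Real.exp_pos _)
    (mul_pos (sub_pos.2 (B.lt_remain₂ ht)) (sub_pos.2 B.w₁_lt_one))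

lemma challengeGain_nonpos_iff {T t : ℝ} (ht : t < T) (q : ℝ) :
    B.challengeGain (B.path₂ T t) q t ≤ 0 ↔ q ≤ B.yieldProb T t := by
  have hpos : 0 < Real.exp (-B.r₁ * t) * ((B.remain₂ T t - B.z₂) * (1 - B.w₁)) :=
    mul_pos (Real.exp_pos _) (mul_pos (sub_pos.2 (B.lt_remain₂ ht)) (sub_pos.2 B.w₁_lt_one))
  rw [challengeGain_path₂ _ ht, ← neg_nonneg, ← mul_neg, mul_nonneg_iff_of_pos_left hpos, neg_sub,
    sub_nonneg]

lemma yieldProb_pos {T t : ℝ} (ht : t < T) : 0 < B.yieldProb T t := by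
  have h1 := sub_pos.2 (B.lt_remain₂ ht)
  refine div_pos (sub_pos.2 (B.w₁_lt_c₁.trans_le ?_)) (sub_pos.2 B.w₁_lt_one)
  rw [le_div_iff₀ h1]
  nlinarith [B.c₁_pos, B.z₂_pos]

/-- Explains `cutoff`: the exponent changes sign exactly when `(1 - c₁) * remain₂ = z₂`, which is
when `yieldProb` reaches 1. -/
lemma one_sub_mul_remain₂ (T t : ℝ) : (1 - B.c₁) * B.remain₂ T t
    = B.z₂ * Real.exp (B.rate₁ * (T + Real.log (1 - B.c₁) / B.rate₁ - t)) := by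
  have h : B.rate₁ * (T + Real.log (1 - B.c₁) / B.rate₁ - t)
      = Real.log (1 - B.c₁) + B.rate₁ * (T - t) := by
    have := B.rate₁_pos.ne'
    field_simp
    ring
  rw [h, Real.exp_add, Real.exp_log (sub_pos.2 B.c₁_lt_one), remain₂]
  ring

lemma lt_mul_remain₂_iff (T t : ℝ) :
    B.z₂ < (1 - B.c₁) * B.remain₂ T t ↔ t < T + Real.log (1 - B.c₁) / B.rate₁ := by
  rw [one_sub_mul_remain₂, lt_mul_iff_one_lt_right B.z₂_pos, Real.one_lt_exp_iff,
    mul_pos_iff_of_pos_left B.rate₁_pos, sub_pos]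

lemma le_mul_remain₂_iff (T t : ℝ) :
    B.z₂ ≤ (1 - B.c₁) * B.remain₂ T t ↔ t ≤ T + Real.log (1 - B.c₁) / B.rate₁ := by
  rw [one_sub_mul_remain₂, le_mul_iff_one_le_right B.z₂_pos, Real.one_le_exp_iff,
    mul_nonneg_iff_of_pos_left B.rate₁_pos, sub_nonneg]

lemma yieldProb_lt_one {T t : ℝ} (h0 : 0 ≤ t) (ht : t < B.cutoff T) (hT : t < T) :
    B.yieldProb T t < 1 := by
  have h1 := sub_pos.2 (B.lt_remain₂ hT)
  have h2 := (B.lt_mul_remain₂_iff T t).2 ((lt_max_iff.1 ht).resolve_left h0.not_gt)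
  rw [yieldProb, div_lt_one (sub_pos.2 B.w₁_lt_one), sub_lt_sub_iff_right, div_lt_one h1]
  linarith

lemma one_le_yieldProb {T t : ℝ} (ht : B.cutoff T ≤ t) (hT : t < T) : 1 ≤ B.yieldProb T t := by
  have h1 := sub_pos.2 (B.lt_remain₂ hT)
  have h2 : ¬ B.z₂ < (1 - B.c₁) * B.remain₂ T t := by
    rw [lt_mul_remain₂_iff, not_lt]
    exact (le_max_right _ _).trans ht
  rw [yieldProb, le_div_iff₀ (sub_pos.2 B.w₁_lt_one), one_mul, sub_le_sub_iff_right, le_div_iff₀ h1]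
  linarith

lemma measurable_yieldProb (T : ℝ) : Measurable (B.yieldProb T) := by
  unfold yieldProb remain₂
  fun_prop

end UltimatumGame

/-! ### Every equilibrium follows the explicit paths. -/

namespace UltimatumGame

variable {B : UltimatumGame} {σ₁ : Strategy₁} {σ₂ : Strategy₂}

lemma exists_eq_path₂ {T m : ℝ} (h : ∀ t ∈ Icc 0 T, B.wait₁ σ₂ t = m) :
    ∃ x, T ≤ x ∧ ∀ t ∈ Icc 0 T, σ₂.F t = B.path₂ x t := by
  have hS : B.z₂ ≤ 1 - (1 - B.z₂) * σ₂.F T := B.survival₂_pos σ₂ T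
  set S := 1 - (1 - B.z₂) * σ₂.F T with hSdef
  have hz := B.z₂_pos
  -- The end point is extrapolated: decaying at `rate₁` from its value `S` at `T`, the remaining
  -- probability would reach `z₂` at this time.
  have hx : B.remain₂ (T + Real.log (S / B.z₂) / B.rate₁) T = S := by
    rw [remain₂, add_sub_cancel_left, mul_div_cancel₀ _ B.rate₁_pos.ne',
      Real.exp_log (div_pos (hz.trans_le hS) hz), mul_div_cancel₀ _ hz.ne']
  refine ⟨T + Real.log (S / B.z₂) / B.rate₁, le_add_of_nonneg_right
    (div_nonneg (Real.log_nonneg ((one_le_div hz).2 hS)) B.rate₁_pos.le), ?_⟩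
  refine eq_of_waitValue_const (p := 1 - B.z₂) (r := B.r₁) (l := B.rate₁)
    (C := fun _ => 0) (C' := fun _ => 0) B.one_sub_z₂_pos.ne' (stieltjes_intervalIntegrable _)
    (fun a b => (B.continuous_path₂ _).intervalIntegrable a b) (fun _ _ => by simp)
    (fun _ _ => by simp) (fun _ _ => rfl) h (fun t ht => B.waitValue_path₂ _ ht.1) ?_
  rw [path₂, hx, hSdef, eq_div_iff B.one_sub_z₂_pos.ne']
  ring

lemma le_of_remain₂_zero_le {x : ℝ} (h : B.remain₂ x 0 ≤ 1) :
    x ≤ -Real.log B.z₂ / B.rate₁ := by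
  rw [le_div_iff₀ B.rate₁_pos, ← Real.exp_le_exp, Real.exp_neg, Real.exp_log B.z₂_pos,
    le_inv_comm₀ (Real.exp_pos _) B.z₂_pos, ← one_div, le_div_iff₀ (Real.exp_pos _)]
  simpa [remain₂, mul_comm] using h

/-- Indifference makes player 2's remaining probability, at most 1 initially, decay at `rate₁`, yet
it never falls below `z₂`. -/
lemma le_of_wait₁_eq {T m : ℝ} (h : ∀ t ∈ Ico 0 T, B.wait₁ σ₂ t = m) :
    T ≤ max 0 (-Real.log B.z₂ / B.rate₁) := by
  by_contra! hlt
  obtain ⟨S, h1, h2⟩ := exists_between hlt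
  have hS0 : 0 < S := (le_max_left _ _).trans_lt h1
  obtain ⟨x, hx, hF⟩ := exists_eq_path₂ (T := S) (fun t ht => h t ⟨ht.1, ht.2.trans_lt h2⟩)
  have h3 := B.one_sub_mul_path₂ x 0
  rw [← hF 0 ⟨le_rfl, hS0.le⟩] at h3
  have h4 : B.remain₂ x 0 ≤ 1 := by
    have := mul_nonneg B.one_sub_z₂_pos.le (stieltjes_nonneg σ₂.F_neg 0)
    linarith
  have h5 := le_of_remain₂_zero_le h4
  exact absurd ((le_max_right _ _).trans_lt h1) (not_lt.2 (hx.trans h5))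

namespace IsEquilibrium

/-- Concessions end exactly at the time `T`. -/
structure ExitsAt (σ₁ : Strategy₁) (σ₂ : Strategy₂) (T : ℝ) : Prop where
  pos : 0 < T
  strictMonoOn₁ : StrictMonoOn σ₁.F (Ico 0 T)
  strictMonoOn₂ : StrictMonoOn σ₂.F (Ico 0 T)
  const₁ : ∀ t, T ≤ t → σ₁.F t = σ₁.F T
  const₂ : ∀ t, T ≤ t → σ₂.F t = σ₂.F T

variable {T : ℝ}

lemma exists_exitsAt (h : B.IsEquilibrium σ₁ σ₂) : ∃ T, ExitsAt σ₁ σ₂ T := by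
  obtain ⟨T, hT, hm₂, hm₁, hc₂, hc₁⟩ := h.warSide₁.exists_exit_time h.warSide₂
    ⟨_, fun T _ hT => le_of_wait₁_eq hT⟩
  refine ⟨T, lt_of_le_of_ne hT ?_, hm₁, hm₂, hc₁, hc₂⟩
  -- If `T = 0`, player 2 concedes at once. Player 1 then neither concedes at that atom nor has
  -- anyone to bluff against, contradicting total mass 1.
  rintro rfl
  have hF : ∀ t, 0 ≤ t → σ₂.F t = 1 := fun t ht => by
    rw [hc₂ t ht, ← measure_real_univ_eq σ₂.F_neg σ₂.F_le hc₂, h.ae₂.1]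
  have h1 : σ₁.F.measure = 0 := by
    rw [← ae_eq_bot, ← eventually_false_iff_eq_bot]
    filter_upwards [h.warSide₁.ae, ae_le_of_const hc₁, ae_nonneg_of_neg σ₁.F_neg] with t ht h0 h0'
    have : t = 0 := le_antisymm h0 h0'
    rw [this, jump_zero σ₂.F_neg, hF 0 le_rfl] at ht
    exact one_ne_zero ht.2
  have h2 : σ₁.G.measure = 0 := by
    rw [← ae_eq_bot, ← eventually_false_iff_eq_bot]
    filter_upwards [h.ae_challenge, ae_nonneg_of_neg σ₁.G_neg] with t ht h0
    rw [hF t h0] at ht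
    nlinarith [B.c₁_pos, B.z₂_pos]
  have := h.ae₁.1
  rw [h1, h2] at this
  simp at this

section ExitsAt

variable (h : B.IsEquilibrium σ₁ σ₂) (hT : ExitsAt σ₁ σ₂ T)
include h hT

lemma jump_F₂ {t : ℝ} (ht : t ∈ Ioc 0 T) : jump σ₂.F t = 0 ∧ B.wait₁ σ₂ t = value₁ B σ₁ σ₂ :=
  jump_eq_zero_of_waitValue_eq B.one_sub_z₂_pos _ (fun _ _ => by simp) ht.1
    (fun s hs => h.warSide₁.eq_of_strictMonoOn hT.strictMonoOn₁ s ⟨hs.1, hs.2.trans_le ht.2⟩)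
    (h.wait₁_le t ht.1.le)

lemma jump_F₁ {t : ℝ} (ht : t ∈ Ioc 0 T) : jump σ₁.F t = 0 ∧ B.wait₂ σ₁ t = value₂ B σ₁ σ₂ :=
  jump_eq_zero_of_waitValue_eq B.one_sub_z₁_pos _ (B.intervalIntegrable_challenged _) ht.1
    (fun s hs => h.warSide₂.eq_of_strictMonoOn hT.strictMonoOn₂ s ⟨hs.1, hs.2.trans_le ht.2⟩)
    (h.wait₂_le t ht.1.le)

lemma wait₁_eq {t : ℝ} (ht : t ∈ Icc 0 T) : B.wait₁ σ₂ t = value₁ B σ₁ σ₂ := by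
  rcases ht.1.eq_or_lt with h0 | h0
  · exact h.warSide₁.eq_of_strictMonoOn hT.strictMonoOn₁ t ⟨ht.1, h0 ▸ hT.pos⟩
  · exact (h.jump_F₂ hT ⟨h0, ht.2⟩).2

lemma wait₂_eq {t : ℝ} (ht : t ∈ Icc 0 T) : B.wait₂ σ₁ t = value₂ B σ₁ σ₂ := by
  rcases ht.1.eq_or_lt with h0 | h0
  · exact h.warSide₂.eq_of_strictMonoOn hT.strictMonoOn₂ t ⟨ht.1, h0 ▸ hT.pos⟩
  · exact (h.jump_F₁ hT ⟨h0, ht.2⟩).2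

lemma F₂_exit : σ₂.F T = 1 := by
  rw [← measure_real_univ_eq σ₂.F_neg σ₂.F_le hT.const₂, h.ae₂.1]

lemma F₂_eq_path₂ {t : ℝ} (ht : t ∈ Icc 0 T) : σ₂.F t = B.path₂ T t :=
  eq_of_waitValue_const (p := 1 - B.z₂) (r := B.r₁) (l := B.rate₁)
    (C := fun _ => 0) (C' := fun _ => 0) B.one_sub_z₂_pos.ne' (stieltjes_intervalIntegrable _)
    (fun a b => (B.continuous_path₂ _).intervalIntegrable a b) (fun _ _ => by simp)
    (fun _ _ => by simp) (fun _ _ => rfl) (fun _ => h.wait₁_eq hT)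
    (fun _ ht => B.waitValue_path₂ _ ht.1) (by rw [h.F₂_exit hT, path₂_self]) t ht

lemma F₂_lt_one {t : ℝ} (ht : t < T) : σ₂.F t < 1 := by
  rcases lt_or_ge t 0 with h0 | h0
  · rw [σ₂.F_neg t h0]; exact one_pos
  · rw [h.F₂_eq_path₂ hT ⟨h0, ht.le⟩, path₂, div_lt_one B.one_sub_z₂_pos]
    linarith [B.lt_remain₂ ht]

lemma ae_challenge_le_cutoff : ∀ᵐ t ∂σ₁.G.measure, t ≤ B.cutoff T := by
  filter_upwards [h.ae_challenge, ae_nonneg_of_neg σ₁.G_neg] with t ht h0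
  rcases le_total t T with htT | htT
  · rw [h.F₂_eq_path₂ hT ⟨h0, htT⟩, one_sub_mul_path₂, le_mul_remain₂_iff] at ht
    exact ht.2.trans (le_max_right _ _)
  · rw [hT.const₂ t htT, h.F₂_exit hT] at ht
    nlinarith [B.c₁_pos, B.z₂_pos]

lemma G_const {t : ℝ} (ht : B.cutoff T ≤ t) : σ₁.G t = σ₁.G (B.cutoff T) :=
  eq_of_ae_notMem_Ioc ht ((h.ae_challenge_le_cutoff hT).mono fun _ hs hs' =>
    absurd hs (not_le.2 hs'.1))

lemma exists_optimal_after {t : ℝ} (ht : t < T) : ∃ s, t < s ∧ 0 ≤ s ∧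
    ∀ q', Measurable q' → (∀ u, q' u ∈ Icc (0 : ℝ) 1) → B.U₂ s q' σ₁ ≤ B.U₂ s σ₂.q σ₁ := by
  obtain ⟨s, hs, hs'⟩ := exists_mem_Ioc_of_lt h.ae_nonneg_forall_U₂_le
    (show σ₂.F t < σ₂.F T by rw [h.F₂_exit hT]; exact h.F₂_lt_one hT ht)
  exact ⟨s, hs.1, hs'⟩

lemma q_le_yieldProb {t : ℝ} (h0 : 0 ≤ t) (ht : t < T) : σ₂.q t ≤ B.yieldProb T t := by
  have h1 := h.wait₁_add_le h0
  rw [h.wait₁_eq hT ⟨h0, ht.le⟩, h.F₂_eq_path₂ hT ⟨h0, ht.le⟩] at h1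
  exact (B.challengeGain_nonpos_iff ht _).1 (by linarith)

lemma q_lt_one {t : ℝ} (h0 : 0 ≤ t) (ht : t < B.cutoff T) : σ₂.q t < 1 :=
  have hlt := ht.trans (B.cutoff_lt hT.pos)
  (h.q_le_yieldProb hT h0 hlt).trans_lt (B.yieldProb_lt_one h0 ht hlt)

/-- Before the cutoff a sure yield would make challenging strictly profitable. So `q₂ < 1` there,
and player 2's willingness to resist gives the reverse inequality. -/
lemma gain_eq_cost {A : Set ℝ} (hA : MeasurableSet A) (hAT : A ⊆ Ico 0 (B.cutoff T)) :
    B.gainMeasure σ₁.G A = B.costMeasure A := by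
  refine le_antisymm (h.gain_le_cost A) ?_
  obtain ⟨s, hs, hs0, hopt⟩ := h.exists_optimal_after hT (B.cutoff_lt hT.pos)
  exact cost_le_gain_of_forall_U₂_le hs0 σ₂.q_measurable σ₂.q_mem hopt hA
    (fun t ht => ⟨(hAT ht).1, (hAT ht).2.trans hs⟩)
    (fun t ht => h.q_lt_one hT (hAT ht).1 (hAT ht).2)

end ExitsAt

/-- With an atom at zero player 1 concedes there with positive probability, which rules out an atom
of the opponent. -/
lemma jump_zero_or (h : B.IsEquilibrium σ₁ σ₂) : jump σ₁.F 0 = 0 ∨ jump σ₂.F 0 = 0 := by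
  by_contra! hcon
  have h1 : ∃ᵐ t ∂σ₁.F.measure, t = 0 := by
    rw [Filter.Frequently, ae_iff]
    simp only [not_not, ofPred_eq_eq_singleton, σ₁.F.measure_singleton]
    exact (ENNReal.ofReal_pos.2 (lt_of_le_of_ne (jump_nonneg _ _) hcon.1.symm)).ne'
  obtain ⟨t, ht, ht'⟩ := (h1.and_eventually h.warSide₁.ae).exists
  rw [ht] at ht'
  exact hcon.2 ht'.2

lemma costMeasure_singleton (B : UltimatumGame) (t : ℝ) : B.costMeasure {t} = 0 :=
  withDensity_absolutelyContinuous _ _ (by simp)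

/-- Bluffs are dominated by `costMeasure`, which has a density. -/
lemma jump_G (h : B.IsEquilibrium σ₁ σ₂) (t : ℝ) : jump σ₁.G t = 0 := by
  have h1 := h.gain_le_cost {t}
  rw [costMeasure_singleton, nonpos_iff_eq_zero, gainMeasure, Measure.smul_apply, smul_eq_mul,
    mul_eq_zero, ENNReal.ofReal_eq_zero, σ₁.G.measure_singleton, ENNReal.ofReal_eq_zero] at h1
  exact le_antisymm (h1.resolve_left (not_le.2 B.gain_pos)) (jump_nonneg _ _)

lemma costMeasure_Ioc (B : UltimatumGame) {s t : ℝ} (hst : s ≤ t) : B.costMeasure (Ioc s t)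
    = ENNReal.ofReal (B.z₁ * B.k₂ * (Real.exp (-B.γ₁ * s) - Real.exp (-B.γ₁ * t))) := by
  have hnn : ∀ u, 0 ≤ B.z₁ * B.k₂ * (B.γ₁ * Real.exp (-B.γ₁ * u)) := fun u => by
    have := B.cost_pos; have := B.γ₁_nonneg; positivity
  rw [costMeasure, withDensity_apply _ measurableSet_Ioc, ← ofReal_integral_eq_lintegral_ofReal
    ((by fun_prop : Continuous fun u => B.z₁ * B.k₂ * (B.γ₁ * Real.exp (-B.γ₁ * u))
      ).continuousOn.integrableOn_compact isCompact_Icc |>.mono_set Ioc_subset_Icc_self)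
    (ae_of_all _ hnn), ← intervalIntegral.integral_of_le hst, intervalIntegral.integral_const_mul,
    integral_exp_mul_const]

lemma G_eq_pathG (h : B.IsEquilibrium σ₁ σ₂) (hT : ExitsAt σ₁ σ₂ T) {t : ℝ} (ht : 0 ≤ t) :
    σ₁.G t = B.pathG T t := by
  have hcut : σ₁.G t = σ₁.G (min t (B.cutoff T)) := by
    rcases le_total t (B.cutoff T) with hle | hle
    · rw [min_eq_left hle]
    · rw [min_eq_right hle, h.G_const hT hle]
  have hs0 : 0 ≤ min t (B.cutoff T) := le_min ht (B.cutoff_nonneg T)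
  have hsT : min t (B.cutoff T) ≤ B.cutoff T := min_le_right _ _
  rw [hcut, pathG]
  set s := min t (B.cutoff T)
  have h1 : B.gainMeasure σ₁.G (Ico 0 s) = B.costMeasure (Ico 0 s) :=
    h.gain_eq_cost hT measurableSet_Ico (Ico_subset_Ico_right hsT)
  have h2 : leftLim σ₁.G s = σ₁.G s := by
    have := h.jump_G s
    rw [jump] at this
    linarith
  have h3 : B.costMeasure (Ico 0 s) = B.costMeasure (Ioc 0 s) := by
    have : NullSingletonClass B.costMeasure := ⟨costMeasure_singleton B⟩
    exact measure_congr Ico_ae_eq_Ioc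
  rw [h3, costMeasure_Ioc B hs0, gainMeasure, Measure.smul_apply, σ₁.G.measure_Ico,
    leftLim_of_neg σ₁.G_neg le_rfl, sub_zero, h2, smul_eq_mul,
    ← ENNReal.ofReal_mul B.gain_pos.le, mul_zero, Real.exp_zero] at h1
  have hexp : Real.exp (-B.γ₁ * s) ≤ 1 :=
    Real.exp_le_one_iff.2 (by nlinarith [mul_nonneg B.γ₁_nonneg hs0])
  rw [ENNReal.ofReal_eq_ofReal_iff
    (mul_nonneg B.gain_pos.le (stieltjes_nonneg σ₁.G_neg s))
    (mul_nonneg B.cost_pos.le (sub_nonneg.2 hexp))] at h1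
  have hz := B.one_sub_z₁_pos.ne'
  have hk : 1 - B.w₁ - B.k₂ ≠ 0 := by linarith [B.k₂_lt]
  rw [bluffRatio]
  generalize Real.exp (-B.γ₁ * s) = e at h1 ⊢
  field_simp
  linarith

section ExitsAt

variable (h : B.IsEquilibrium σ₁ σ₂) (hT : ExitsAt σ₁ σ₂ T)
include h hT

lemma F₁_add_G_exit : σ₁.F T + σ₁.G (B.cutoff T) = 1 := by
  rw [← measure_real_univ_eq σ₁.F_neg σ₁.F_le_one hT.const₁,
    ← measure_real_univ_eq σ₁.G_neg σ₁.G_le_one (fun _ => h.G_const hT), h.ae₁.1]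

lemma F₁_eq_path₁ {t : ℝ} (ht : t ∈ Icc 0 T) : σ₁.F t = B.path₁ T t := by
  refine eq_of_waitValue_const (p := 1 - B.z₁) (r := B.r₂) (l := B.rate₂)
    B.one_sub_z₁_pos.ne' (stieltjes_intervalIntegrable _)
    (fun a b => (B.continuous_path₁ _).intervalIntegrable a b)
    (B.intervalIntegrable_challenged σ₁.G)
    (fun a b => (B.continuous_challenged_pathG T).intervalIntegrable a b)
    (fun t ht => ?_) (fun _ => h.wait₂_eq hT)
    (fun _ ht => B.waitValue_path₁ _ ht.1) ?_ t ht
  · rw [challenged, challenged, h.G_eq_pathG hT ht.1]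
  · have h1 := h.F₁_add_G_exit hT
    have h2 := B.path₁_add_pathG hT.pos.le
    rw [← h.G_eq_pathG hT (B.cutoff_nonneg T)] at h2
    linarith

/-- The initial remaining probabilities are at most 1, and the player without an atom at zero
attains 1. -/
lemma level_eq_one : B.level T = 1 := by
  have h0 : (0 : ℝ) ∈ Icc 0 T := ⟨le_rfl, hT.pos.le⟩
  have h1 : B.remain₁ T 0 = 1 - (1 - B.z₁) * σ₁.F 0 := by
    rw [h.F₁_eq_path₁ hT h0, ← one_sub_mul_path₁, challenged, pathG,
      min_eq_left (B.cutoff_nonneg T)]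
    simp
  have h2 : B.remain₂ T 0 = 1 - (1 - B.z₂) * σ₂.F 0 := by
    rw [h.F₂_eq_path₂ hT h0, one_sub_mul_path₂]
  have h3 := mul_nonneg B.one_sub_z₁_pos.le (stieltjes_nonneg σ₁.F_neg 0)
  have h4 := mul_nonneg B.one_sub_z₂_pos.le (stieltjes_nonneg σ₂.F_neg 0)
  have h5 := h.jump_zero_or
  rw [jump_zero σ₁.F_neg, jump_zero σ₂.F_neg] at h5
  rw [level, h1, h2]
  rcases h5 with h5 | h5 <;> rw [h5]
  · rw [mul_zero, sub_zero, max_eq_left]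
    linarith
  · rw [mul_zero, sub_zero, max_eq_right]
    linarith

lemma ae_q_eq (hγ : 0 < B.γ₁) : ∀ᵐ t, (t ∈ Ico 0 (B.cutoff T) → σ₂.q t = B.yieldProb T t) ∧
    (t ∈ Ioo (B.cutoff T) T → σ₂.q t = 1) := by
  have hac : (volume : Measure ℝ) ≪ B.costMeasure := by
    refine withDensity_absolutelyContinuous' (by fun_prop) (ae_of_all _ fun s => ?_)
    exact (ENNReal.ofReal_pos.2
      (mul_pos B.cost_pos (mul_pos hγ (Real.exp_pos _)))).ne'
  refine Eventually.and ?_ ?_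
  · refine hac.ae_le ?_
    set N := Ico 0 (B.cutoff T) ∩ {t | σ₂.q t = B.yieldProb T t}ᶜ with hN
    have hNm : MeasurableSet N := measurableSet_Ico.inter
      (measurableSet_eq_fun σ₂.q_measurable (B.measurable_yieldProb T)).compl
    -- Player 1's indifference pins `q₂` only where bluffs occur. Since gain = cost before the
    -- cutoff, this transfers to `costMeasure`, and to Lebesgue measure as `γ₁ > 0`.
    have hNull : B.costMeasure N = 0 := by
      rw [← h.gain_eq_cost hT hNm inter_subset_left, gainMeasure, Measure.smul_apply]
      have : ∀ᵐ t ∂σ₁.G.measure, t ∉ N := by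
        filter_upwards [h.ae_wait₁_add_eq] with t ht hmem
        have htT := hmem.1.2.trans (B.cutoff_lt hT.pos)
        rw [h.wait₁_eq hT ⟨hmem.1.1, htT.le⟩, h.F₂_eq_path₂ hT ⟨hmem.1.1, htT.le⟩] at ht
        refine hmem.2 (le_antisymm (h.q_le_yieldProb hT hmem.1.1 htT) ?_)
        exact (B.challengeGain_nonneg_iff htT _).1 (by linarith)
      rw [ae_iff] at this
      simp only [not_not, ofPred_mem_eq] at this
      rw [this, smul_zero]
    refine measure_mono_null (fun t ht => ?_) hNull
    simpa [N, and_assoc] using ht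
  · refine hac.ae_le ?_
    -- Optimality of `q₂` is known only before an optimal concession time. Such times exist beyond
    -- each `u n < T`, so `[0,T)` is exhausted from below.
    obtain ⟨u, -, hu, hlim⟩ := exists_seq_strictMono_tendsto T
    have hall : ∀ n, ∀ᵐ t ∂B.costMeasure, t ∈ Ioo (B.cutoff T) (u n) → σ₂.q t = 1 := by
      intro n
      obtain ⟨s, hs, hs0, hopt⟩ := h.exists_optimal_after hT (hu n)
      set N := Ioo (B.cutoff T) (u n) ∩ {t | σ₂.q t < 1}
      have hNm : MeasurableSet N :=
        measurableSet_Ioo.inter (measurableSet_lt σ₂.q_measurable measurable_const)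
      have h1 : B.costMeasure N ≤ B.gainMeasure σ₁.G N :=
        cost_le_gain_of_forall_U₂_le hs0 σ₂.q_measurable σ₂.q_mem hopt hNm
          (fun t ht => ⟨(B.cutoff_nonneg T).trans ht.1.1.le, ht.1.2.trans hs⟩) (fun t ht => ht.2)
      have h2 : B.gainMeasure σ₁.G N = 0 := by
        rw [gainMeasure, Measure.smul_apply]
        have : σ₁.G.measure N = 0 :=
          measure_mono_null (fun t ht => not_le.2 ht.1.1) (ae_iff.1 (h.ae_challenge_le_cutoff hT))
        rw [this, smul_zero]
      rw [h2, nonpos_iff_eq_zero] at h1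
      rw [ae_iff]
      refine measure_mono_null (fun t ht => ?_) h1
      simp only [mem_ofPred_eq, Classical.not_imp] at ht
      exact ⟨ht.1, lt_of_le_of_ne (σ₂.q_mem t).2 ht.2⟩
    filter_upwards [ae_all_iff.2 hall] with t ht hmem
    obtain ⟨n, hn⟩ := (hlim.eventually (lt_mem_nhds hmem.2)).exists
    exact ht n ⟨hmem.1, hn⟩

end ExitsAt

end IsEquilibrium

end UltimatumGame

/-! ### Existence: the paths with `level T = 1` form an equilibrium. -/

/-- The distribution function on `[0,∞)` that follows `φ` until time `T`. -/
def stopped (φ : ℝ → ℝ) (T : ℝ) (hT : 0 ≤ T) (hc : Continuous φ) (h0 : 0 ≤ φ 0)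
    (hm : MonotoneOn φ (Icc 0 T)) : StieltjesFunction ℝ where
  toFun t := if t < 0 then 0 else φ (min t T)
  mono' s t hst := by
    have hmem : ∀ u, 0 ≤ u → min u T ∈ Icc 0 T := fun u hu => ⟨le_min hu hT, min_le_right _ _⟩
    beta_reduce
    split_ifs with h1 h2 h2
    · exact le_rfl
    · exact h0.trans (hm ⟨le_rfl, hT⟩ (hmem t (not_lt.1 h2)) (hmem t (not_lt.1 h2)).1)
    · linarith
    · exact hm (hmem s (not_lt.1 h1)) (hmem t (not_lt.1 h2)) (min_le_min_right T hst)
  right_continuous' t := by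
    rcases lt_or_ge t 0 with h | h
    · refine (continuousAt_const (y := (0 : ℝ))).continuousWithinAt.congr_of_eventuallyEq ?_
        (by simp [h])
      filter_upwards [mem_nhdsWithin_of_mem_nhds (Iio_mem_nhds h)] with s hs
      exact if_pos hs
    · refine (by fun_prop : Continuous fun s => φ (min s T)).continuousWithinAt.congr
        (fun s hs => if_neg (not_lt.2 (h.trans hs))) (if_neg (not_lt.2 h))

/-- `F` is the distribution function on `[0,∞)` that follows `φ` until time `T`. -/
structure IsStopped (F : StieltjesFunction ℝ) (φ : ℝ → ℝ) (T : ℝ) : Prop where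
  nonneg : 0 ≤ T
  continuous : Continuous φ
  of_neg : ∀ t < 0, F t = 0
  of_nonneg : ∀ t, 0 ≤ t → F t = φ (min t T)

lemma isStopped_stopped {φ : ℝ → ℝ} {T : ℝ} (hT : 0 ≤ T) (hc : Continuous φ) (h0 : 0 ≤ φ 0)
    (hm : MonotoneOn φ (Icc 0 T)) : IsStopped (stopped φ T hT hc h0 hm) φ T where
  nonneg := hT
  continuous := hc
  of_neg _ ht := if_pos ht
  of_nonneg _ ht := if_neg (not_lt.2 ht)

namespace IsStopped

variable {F : StieltjesFunction ℝ} {φ : ℝ → ℝ} {T t : ℝ} (h : IsStopped F φ T)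
include h

lemma of_mem (ht : t ∈ Icc 0 T) : F t = φ t := by
  rw [h.of_nonneg t ht.1, min_eq_left ht.2]

lemma of_le (ht : T ≤ t) : F t = φ T := by
  rw [h.of_nonneg t (h.nonneg.trans ht), min_eq_right ht]

lemma const (t : ℝ) (ht : T ≤ t) : F t = F T := by
  rw [h.of_le ht, h.of_le le_rfl]

lemma le (t : ℝ) : F t ≤ φ T := by
  rw [← h.of_le (le_max_right t T)]
  exact F.mono (le_max_left t T)

lemma jump_eq_zero (ht : 0 < t) : jump F t = 0 := by
  have hφ := h.continuous
  have hcont : ContinuousAt F t := by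
    refine (by fun_prop : Continuous fun s => φ (min s T)).continuousAt.congr ?_
    filter_upwards [Ioi_mem_nhds ht] with s hs
    exact (h.of_nonneg s (le_of_lt hs)).symm
  rw [jump, leftLim_eq_of_tendsto (hcont.tendsto.mono_left nhdsWithin_le_nhds), sub_self]

lemma jump_zero : jump F 0 = φ 0 := by
  rw [_root_.jump_zero h.of_neg, h.of_mem ⟨le_rfl, h.nonneg⟩]

end IsStopped

lemma waitValue_congr {p r l : ℝ} {F F' C C' : ℝ → ℝ} {t : ℝ} (ht : 0 ≤ t)
    (hF : ∀ s ∈ Icc 0 t, F s = F' s) (hC : ∀ s ∈ Icc 0 t, C s = C' s) :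
    waitValue p r l F C t = waitValue p r l F' C' t := by
  rw [waitValue, waitValue, hF t ⟨ht, le_rfl⟩]
  congr 1
  refine intervalIntegral.integral_congr fun s hs => ?_
  rw [uIcc_of_le ht] at hs
  simp only [hF s hs, hC s hs]

lemma ae_ne_zero_of_jump_eq_zero {F : StieltjesFunction ℝ} {t : ℝ} (h : jump F t = 0) :
    ∀ᵐ s ∂F.measure, s ≠ t := by
  rw [ae_iff]
  simp only [ne_eq, not_not, ofPred_eq_eq_singleton]
  rw [F.measure_singleton, ENNReal.ofReal_eq_zero]
  exact h.le

namespace UltimatumGame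

variable (B : UltimatumGame)

/-- The right derivative is `rate₂ * remain₁` up to a positive factor, and `remain₁_pos` applies up
to `T`. -/
lemma monotoneOn_path₁ (T : ℝ) : MonotoneOn (B.path₁ T) (Icc 0 T) := by
  intro s hs t ht hst
  have h := image_le_of_deriv_right_le_deriv_boundary (a := s) (b := t)
    (f := fun _ => (1 - B.z₁) * B.path₁ T s) (f' := fun _ => 0)
    (B := fun u => (1 - B.z₁) * B.path₁ T u) (B' := fun u => B.rate₂ * B.remain₁ T u)
    continuousOn_const (fun x _ => hasDerivWithinAt_const _ _ _) le_rfl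
    (continuous_const.mul (B.continuous_path₁ T)).continuousOn
    (fun x _ => B.hasDerivWithinAt_path₁ T x)
    (fun x hx => (mul_pos B.rate₂_pos (B.remain₁_pos (hx.2.le.trans ht.2))).le)
    ⟨hst, le_rfl⟩
  exact le_of_mul_le_mul_left h B.one_sub_z₁_pos

lemma monotone_path₂ (T : ℝ) : Monotone (B.path₂ T) := by
  intro s t hst
  have h1 : B.remain₂ T t ≤ B.remain₂ T s :=
    mul_le_mul_of_nonneg_left (Real.exp_le_exp.2
      (mul_le_mul_of_nonneg_left (by linarith) B.rate₁_pos.le)) B.z₂_pos.le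
  exact div_le_div_of_nonneg_right (by linarith) B.one_sub_z₂_pos.le

lemma monotone_pathG (T : ℝ) : Monotone (B.pathG T) := by
  intro s t hst
  have h1 : Real.exp (-B.γ₁ * min t (B.cutoff T)) ≤ Real.exp (-B.γ₁ * min s (B.cutoff T)) :=
    Real.exp_le_exp.2 (mul_le_mul_of_nonpos_left (min_le_min_right _ hst)
      (neg_nonpos.2 B.γ₁_nonneg))
  refine mul_le_mul_of_nonneg_left (by linarith) ?_
  exact div_nonneg (mul_nonneg B.bluffRatio_pos.le B.z₁_pos.le) B.one_sub_z₁_pos.le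

lemma pathG_zero (T : ℝ) : B.pathG T 0 = 0 := by
  simp [pathG, min_eq_left (B.cutoff_nonneg T)]

lemma pathG_min {T : ℝ} (hT : 0 ≤ T) (t : ℝ) : B.pathG T (min t T) = B.pathG T t := by
  rw [pathG, min_assoc, min_eq_right (B.cutoff_le hT), pathG]

lemma path₁_zero (T : ℝ) : B.path₁ T 0 = (1 - B.remain₁ T 0) / (1 - B.z₁) := by
  rw [path₁, challenged, pathG_zero]
  simp

lemma path₁_add_pathG_self {T : ℝ} (hT : 0 ≤ T) : B.path₁ T T + B.pathG T T = 1 := by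
  rw [← B.path₁_add_pathG hT, pathG, pathG, min_eq_right (B.cutoff_le hT), min_self]

section Existence

variable {T : ℝ} (hT : 0 < T) (hl : B.level T = 1)

include hl in
lemma path₁_zero_nonneg : 0 ≤ B.path₁ T 0 := by
  rw [path₁_zero]
  exact div_nonneg (sub_nonneg.2 (hl ▸ le_max_left _ _)) B.one_sub_z₁_pos.le

include hl in
lemma path₂_zero_nonneg : 0 ≤ B.path₂ T 0 :=
  div_nonneg (sub_nonneg.2 (hl ▸ le_max_right _ _)) B.one_sub_z₂_pos.le

include hl in
lemma path_zero_eq_zero_or : B.path₁ T 0 = 0 ∨ B.path₂ T 0 = 0 := by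
  rw [path₁_zero, path₂]
  rcases max_choice (B.remain₁ T 0) (B.remain₂ T 0) with h | h <;> rw [← level, hl] at h
  · left; rw [← h]; simp
  · right; rw [← h]; simp

/-- The equilibrium strategy of player 1. -/
def equilibrium₁ : Strategy₁ where
  F := stopped (B.path₁ T) T hT.le (B.continuous_path₁ T) (B.path₁_zero_nonneg hl)
    (B.monotoneOn_path₁ T)
  G := stopped (B.pathG T) T hT.le (B.continuous_pathG T) (B.pathG_zero T).ge
    ((B.monotone_pathG T).monotoneOn _)
  F_neg := (isStopped_stopped _ _ _ _).of_neg
  G_neg := (isStopped_stopped _ _ _ _).of_neg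
  F_add_G_le t := by
    refine (add_le_add ((isStopped_stopped _ _ _ _).le t) ((isStopped_stopped _ _ _ _).le t)).trans
      ?_
    rw [B.path₁_add_pathG_self hT.le]

/-- The equilibrium strategy of player 2. -/
def equilibrium₂ : Strategy₂ where
  F := stopped (B.path₂ T) T hT.le (B.continuous_path₂ T) (B.path₂_zero_nonneg hl)
    ((B.monotone_path₂ T).monotoneOn _)
  q t := if t ∈ Ico 0 (B.cutoff T) then B.yieldProb T t else 1
  F_neg := (isStopped_stopped _ _ _ _).of_neg
  F_le t := ((isStopped_stopped _ _ _ _).le t).trans (B.path₂_self T).le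
  q_measurable := Measurable.ite measurableSet_Ico (B.measurable_yieldProb T) measurable_const
  q_mem t := by
    split_ifs with ht
    · have htT := ht.2.trans (B.cutoff_lt hT)
      exact ⟨(B.yieldProb_pos htT).le, (B.yieldProb_lt_one ht.1 ht.2 htT).le⟩
    · exact ⟨zero_le_one, le_rfl⟩

lemma isStopped_F₁ : IsStopped (B.equilibrium₁ hT hl).F (B.path₁ T) T :=
  isStopped_stopped hT.le (B.continuous_path₁ T) (B.path₁_zero_nonneg hl) (B.monotoneOn_path₁ T)

lemma isStopped_G : IsStopped (B.equilibrium₁ hT hl).G (B.pathG T) T :=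
  isStopped_stopped hT.le (B.continuous_pathG T) (B.pathG_zero T).ge
    ((B.monotone_pathG T).monotoneOn _)

lemma isStopped_F₂ : IsStopped (B.equilibrium₂ hT hl).F (B.path₂ T) T :=
  isStopped_stopped hT.le (B.continuous_path₂ T) (B.path₂_zero_nonneg hl)
    ((B.monotone_path₂ T).monotoneOn _)

lemma equilibrium₂_q_of_mem {t : ℝ} (ht : t ∈ Ico 0 (B.cutoff T)) :
    (B.equilibrium₂ hT hl).q t = B.yieldProb T t := if_pos ht

lemma equilibrium₂_q_of_notMem {t : ℝ} (ht : t ∉ Ico 0 (B.cutoff T)) :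
    (B.equilibrium₂ hT hl).q t = 1 := if_neg ht

lemma equilibrium₁_G {t : ℝ} (ht : 0 ≤ t) : (B.equilibrium₁ hT hl).G t = B.pathG T t := by
  rw [← B.pathG_min hT.le]
  exact (B.isStopped_G hT hl).of_nonneg t ht

lemma equilibrium₁_measure : (B.equilibrium₁ hT hl).F.measure.real univ
    + (B.equilibrium₁ hT hl).G.measure.real univ = 1 := by
  rw [measure_real_univ_eq (B.equilibrium₁ hT hl).F_neg (B.equilibrium₁ hT hl).F_le_one
    (B.isStopped_F₁ hT hl).const, measure_real_univ_eq (B.equilibrium₁ hT hl).G_neg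
    (B.equilibrium₁ hT hl).G_le_one (B.isStopped_G hT hl).const,
    (B.isStopped_F₁ hT hl).of_le le_rfl, (B.isStopped_G hT hl).of_le le_rfl,
    B.path₁_add_pathG_self hT.le]

lemma equilibrium₂_measure : (B.equilibrium₂ hT hl).F.measure.real univ = 1 := by
  rw [measure_real_univ_eq (B.equilibrium₂ hT hl).F_neg (B.equilibrium₂ hT hl).F_le
    (B.isStopped_F₂ hT hl).const, (B.isStopped_F₂ hT hl).of_le le_rfl, path₂_self]

lemma wait₁_equilibrium {t : ℝ} (ht : t ∈ Icc 0 T) :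
    B.wait₁ (B.equilibrium₂ hT hl) t = (1 - B.z₂) * B.path₂ T 0 := by
  rw [← B.waitValue_path₂ T ht.1, wait₁]
  exact waitValue_congr ht.1 (fun s hs => (B.isStopped_F₂ hT hl).of_mem ⟨hs.1, hs.2.trans ht.2⟩)
    fun _ _ => rfl

lemma wait₂_equilibrium {t : ℝ} (ht : t ∈ Icc 0 T) :
    B.wait₂ (B.equilibrium₁ hT hl) t = (1 - B.z₁) * B.path₁ T 0 := by
  rw [← B.waitValue_path₁ T ht.1, wait₂]
  exact waitValue_congr ht.1 (fun s hs => (B.isStopped_F₁ hT hl).of_mem ⟨hs.1, hs.2.trans ht.2⟩)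
    fun s hs => by rw [challenged, challenged, equilibrium₁_G _ _ _ hs.1]

lemma wait₁_equilibrium_le {t : ℝ} (ht : 0 ≤ t) :
    B.wait₁ (B.equilibrium₂ hT hl) t ≤ (1 - B.z₂) * B.path₂ T 0 := by
  rcases le_or_gt t T with htT | htT
  · exact (B.wait₁_equilibrium hT hl ⟨ht, htT⟩).le
  · rw [← B.wait₁_equilibrium hT hl ⟨hT.le, le_rfl⟩]
    refine (waitValue_lt_of_const (stieltjes_intervalIntegrable _) (fun _ _ => by simp)
      B.rate₁_pos htT (fun u hu => (B.isStopped_F₂ hT hl).const u hu.1) (fun u _ => ?_)).le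
    linarith [B.survival₂_pos (B.equilibrium₂ hT hl) u, B.z₂_pos]

lemma wait₂_equilibrium_le {t : ℝ} (ht : 0 ≤ t) :
    B.wait₂ (B.equilibrium₁ hT hl) t ≤ (1 - B.z₁) * B.path₁ T 0 := by
  rcases le_or_gt t T with htT | htT
  · exact (B.wait₂_equilibrium hT hl ⟨ht, htT⟩).le
  · rw [← B.wait₂_equilibrium hT hl ⟨hT.le, le_rfl⟩]
    exact (waitValue_lt_of_const (stieltjes_intervalIntegrable _)
      (B.intervalIntegrable_challenged _) B.rate₂_pos htT
      (fun u hu => (B.isStopped_F₁ hT hl).const u hu.1) (fun u _ => B.survival₁_pos _ u)).le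

lemma challengeGain_equilibrium_nonpos {t : ℝ} (ht : 0 ≤ t) :
    B.challengeGain ((B.equilibrium₂ hT hl).F t) ((B.equilibrium₂ hT hl).q t) t ≤ 0 := by
  rcases lt_or_ge t T with htT | htT
  · rw [(B.isStopped_F₂ hT hl).of_mem ⟨ht, htT.le⟩,
      B.challengeGain_nonpos_iff htT]
    by_cases h : t < B.cutoff T
    · exact (B.equilibrium₂_q_of_mem hT hl ⟨ht, h⟩).le
    · refine (B.equilibrium₂_q_of_notMem hT hl fun h' => h h'.2).le.trans ?_
      exact B.one_le_yieldProb (not_lt.1 h) htT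
  · rw [(B.isStopped_F₂ hT hl).of_le htT, path₂_self, challengeGain]
    refine mul_nonpos_of_nonneg_of_nonpos (Real.exp_pos _).le ?_
    nlinarith [mul_pos B.c₁_pos B.z₂_pos]

lemma challengeGain_equilibrium_eq {t : ℝ} (ht : t ∈ Ico 0 (B.cutoff T)) :
    B.challengeGain ((B.equilibrium₂ hT hl).F t) ((B.equilibrium₂ hT hl).q t) t = 0 := by
  have htT := ht.2.trans (B.cutoff_lt hT)
  rw [(B.isStopped_F₂ hT hl).of_mem ⟨ht.1, htT.le⟩, B.equilibrium₂_q_of_mem hT hl ht,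
    B.challengeGain_path₂ htT, sub_self, mul_zero]

/-- `bluffRatio` is chosen so that gain and cost balance exactly until the cutoff. -/
lemma gainMeasure_equilibrium : B.gainMeasure (B.equilibrium₁ hT hl).G
    = B.costMeasure.restrict (Ico 0 (B.cutoff T)) := by
  have : NullSingletonClass B.costMeasure := ⟨IsEquilibrium.costMeasure_singleton B⟩
  rw [Measure.restrict_congr_set Ico_ae_eq_Ioc]
  refine Measure.ext_of_Iic _ _ fun t => ?_
  rw [Measure.restrict_apply measurableSet_Iic, inter_comm, Ioc_inter_Iic, gainMeasure,
    Measure.smul_apply, measure_Iic_of_neg (B.equilibrium₁ hT hl).G_neg, smul_eq_mul]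
  rcases lt_or_ge t 0 with ht | ht
  · rw [(B.equilibrium₁ hT hl).G_neg t ht, Ioc_eq_empty (by simp [ht.le])]
    simp
  · rw [equilibrium₁_G _ _ _ ht,
      IsEquilibrium.costMeasure_Ioc B (le_min (B.cutoff_nonneg T) ht),
      ← ENNReal.ofReal_mul B.gain_pos.le, pathG, bluffRatio, min_comm t, mul_zero, Real.exp_zero]
    congr 1
    have hz := B.one_sub_z₁_pos.ne'
    have hk : 1 - B.w₁ - B.k₂ ≠ 0 := by linarith [B.k₂_lt]
    field_simp

lemma gain_le_cost_equilibrium : B.gainMeasure (B.equilibrium₁ hT hl).G ≤ B.costMeasure := by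
  rw [gainMeasure_equilibrium]
  exact Measure.restrict_le_self

/-- Player 2 resists only before the cutoff, where gain and cost coincide, so resisting makes no
difference. -/
lemma U₂_equilibrium {t : ℝ} (ht : 0 ≤ t) :
    B.U₂ t (B.equilibrium₂ hT hl).q (B.equilibrium₁ hT hl)
      = B.U₂ t (fun _ => 1) (B.equilibrium₁ hT hl) := by
  rw [B.U₂_eq_add _ ht (B.equilibrium₂ hT hl).q_measurable (B.equilibrium₂ hT hl).q_mem,
    gainMeasure_equilibrium, Measure.restrict_restrict measurableSet_Ico,
    ← setIntegral_indicator measurableSet_Ico]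
  have : (Ico 0 (B.cutoff T)).indicator
      (fun s => (1 - (B.equilibrium₂ hT hl).q s) * Real.exp (-B.r₂ * s))
      = fun s => (1 - (B.equilibrium₂ hT hl).q s) * Real.exp (-B.r₂ * s) := by
    refine indicator_eq_self.2 fun s hs => ?_
    by_contra hmem
    refine hs ?_
    beta_reduce
    rw [B.equilibrium₂_q_of_notMem hT hl hmem]
    simp
  rw [this, sub_self, mul_zero, add_zero]

lemma ae_jump_F₂_equilibrium : ∀ᵐ t ∂(B.equilibrium₁ hT hl).F.measure,
    jump (B.equilibrium₂ hT hl).F t = 0 := by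
  rcases B.path_zero_eq_zero_or hl with h | h
  · filter_upwards [ae_nonneg_of_neg (B.equilibrium₁ hT hl).F_neg,
      ae_ne_zero_of_jump_eq_zero ((B.isStopped_F₁ hT hl).jump_zero.trans h)] with t ht hne
    exact (B.isStopped_F₂ hT hl).jump_eq_zero (lt_of_le_of_ne ht hne.symm)
  · filter_upwards [ae_nonneg_of_neg (B.equilibrium₁ hT hl).F_neg] with t ht
    rcases ht.eq_or_lt with rfl | ht
    · exact (B.isStopped_F₂ hT hl).jump_zero.trans h
    · exact (B.isStopped_F₂ hT hl).jump_eq_zero ht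

lemma ae_jump_F₁_equilibrium : ∀ᵐ t ∂(B.equilibrium₂ hT hl).F.measure,
    jump (B.equilibrium₁ hT hl).F t = 0 := by
  rcases B.path_zero_eq_zero_or hl with h | h
  · filter_upwards [ae_nonneg_of_neg (B.equilibrium₂ hT hl).F_neg] with t ht
    rcases ht.eq_or_lt with rfl | ht
    · exact (B.isStopped_F₁ hT hl).jump_zero.trans h
    · exact (B.isStopped_F₁ hT hl).jump_eq_zero ht
  · filter_upwards [ae_nonneg_of_neg (B.equilibrium₂ hT hl).F_neg,
      ae_ne_zero_of_jump_eq_zero ((B.isStopped_F₂ hT hl).jump_zero.trans h)] with t ht hne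
    exact (B.isStopped_F₁ hT hl).jump_eq_zero (lt_of_le_of_ne ht hne.symm)

lemma ae_challenge_equilibrium : ∀ᵐ t ∂(B.equilibrium₁ hT hl).G.measure,
    t ∈ Ico 0 (B.cutoff T) := by
  have hconst : ∀ t, B.cutoff T ≤ t →
      (B.equilibrium₁ hT hl).G t = (B.equilibrium₁ hT hl).G (B.cutoff T) := fun t ht => by
    rw [equilibrium₁_G _ _ _ ((B.cutoff_nonneg T).trans ht),
      equilibrium₁_G _ _ _ (B.cutoff_nonneg T), pathG, pathG, min_eq_right ht, min_self]
  have hjump : jump (B.equilibrium₁ hT hl).G (B.cutoff T) = 0 := by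
    rcases (B.cutoff_nonneg T).eq_or_lt with h | h
    · rw [← h]
      exact (B.isStopped_G hT hl).jump_zero.trans (B.pathG_zero T)
    · exact (B.isStopped_G hT hl).jump_eq_zero h
  filter_upwards [ae_nonneg_of_neg (B.equilibrium₁ hT hl).G_neg, ae_le_of_const hconst,
    ae_ne_zero_of_jump_eq_zero hjump] with t h0 h1 h2
  exact ⟨h0, lt_of_le_of_ne h1 h2⟩

lemma U₁_le_of_wait₁_le {σ₂ : Strategy₂} {m t : ℝ} (ht : 0 ≤ t) (h : B.wait₁ σ₂ t ≤ m) :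
    B.U₁ t σ₂ ≤ (1 - B.a₂) + B.D * m := by
  rw [U₁_eq _ _ ht, add_le_add_iff_left, mul_le_mul_iff_right₀ B.D_pos]
  have : 0 ≤ (1 - B.z₂) * Real.exp (-B.r₁ * t) * jump σ₂.F t :=
    mul_nonneg (mul_pos B.one_sub_z₂_pos (Real.exp_pos _)).le (jump_nonneg _ _)
  linarith

lemma U₂_one_le_of_wait₂_le {σ₁ : Strategy₁} {m t : ℝ} (ht : 0 ≤ t) (h : B.wait₂ σ₁ t ≤ m) :
    B.U₂ t (fun _ => 1) σ₁ ≤ (1 - B.a₁) + B.D * m := by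
  rw [U₂_one_eq _ _ ht, add_le_add_iff_left, mul_le_mul_iff_right₀ B.D_pos]
  have : 0 ≤ (1 - B.z₁) * Real.exp (-B.r₂ * t) * jump σ₁.F t :=
    mul_nonneg (mul_pos B.one_sub_z₁_pos (Real.exp_pos _)).le (jump_nonneg _ _)
  linarith

lemma u₁_equilibrium : B.u₁ (B.equilibrium₁ hT hl) (B.equilibrium₂ hT hl)
    = (1 - B.a₂) + B.D * ((1 - B.z₂) * B.path₂ T 0) := by
  have hU : ∀ᵐ t ∂(B.equilibrium₁ hT hl).F.measure, B.U₁ t (B.equilibrium₂ hT hl)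
      = (1 - B.a₂) + B.D * ((1 - B.z₂) * B.path₂ T 0) := by
    filter_upwards [ae_nonneg_of_neg (B.equilibrium₁ hT hl).F_neg,
      ae_le_of_const (B.isStopped_F₁ hT hl).const, B.ae_jump_F₂_equilibrium hT hl]
      with t h0 h1 h2
    rw [U₁_eq _ _ h0, h2, B.wait₁_equilibrium hT hl ⟨h0, h1⟩]
    simp
  have hV : ∀ᵐ t ∂(B.equilibrium₁ hT hl).G.measure, B.V₁ t (B.equilibrium₂ hT hl)
      = (1 - B.a₂) + B.D * ((1 - B.z₂) * B.path₂ T 0) := by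
    filter_upwards [B.ae_challenge_equilibrium hT hl] with t ht
    rw [V₁_eq _ _ ht.1, B.challengeGain_equilibrium_eq hT hl ht,
      B.wait₁_equilibrium hT hl ⟨ht.1, ht.2.le.trans (B.cutoff_le hT.le)⟩, add_zero]
  rw [u₁, restrict_Ici_of_neg (B.equilibrium₁ hT hl).F_neg,
    restrict_Ici_of_neg (B.equilibrium₁ hT hl).G_neg, integral_congr_ae hU, integral_congr_ae hV,
    integral_const, integral_const, smul_eq_mul, smul_eq_mul, ← add_mul, equilibrium₁_measure,
    one_mul]

lemma u₂_equilibrium : B.u₂ (B.equilibrium₂ hT hl) (B.equilibrium₁ hT hl)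
    = (1 - B.a₁) + B.D * ((1 - B.z₁) * B.path₁ T 0) := by
  have hU : ∀ᵐ t ∂(B.equilibrium₂ hT hl).F.measure,
      B.U₂ t (B.equilibrium₂ hT hl).q (B.equilibrium₁ hT hl)
      = (1 - B.a₁) + B.D * ((1 - B.z₁) * B.path₁ T 0) := by
    filter_upwards [ae_nonneg_of_neg (B.equilibrium₂ hT hl).F_neg,
      ae_le_of_const (B.isStopped_F₂ hT hl).const,
      B.ae_jump_F₁_equilibrium hT hl] with t h0 h1 h2
    rw [U₂_equilibrium _ _ _ h0, U₂_one_eq _ _ h0, h2, B.wait₂_equilibrium hT hl ⟨h0, h1⟩]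
    simp
  rw [u₂, restrict_Ici_of_neg (B.equilibrium₂ hT hl).F_neg, integral_congr_ae hU,
    integral_const, smul_eq_mul, equilibrium₂_measure, one_mul]

/-- Each pure action of player 1, and each concession time of player 2 with any response rule, earns
at most the value attained on the support. Positivity of that value covers deviations of total mass
below 1. -/
lemma isEquilibrium_equilibrium :
    B.IsEquilibrium (B.equilibrium₁ hT hl) (B.equilibrium₂ hT hl) := by
  have hM₁ : 0 < (1 - B.a₂) + B.D * ((1 - B.z₂) * B.path₂ T 0) :=
    add_pos_of_pos_of_nonneg (sub_pos.2 B.a₂_lt_one)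
      (mul_nonneg B.D_pos.le (mul_nonneg B.one_sub_z₂_pos.le (B.path₂_zero_nonneg hl)))
  have hM₂ : 0 < (1 - B.a₁) + B.D * ((1 - B.z₁) * B.path₁ T 0) :=
    add_pos_of_pos_of_nonneg (sub_pos.2 B.a₁_lt_one)
      (mul_nonneg B.D_pos.le (mul_nonneg B.one_sub_z₁_pos.le (B.path₁_zero_nonneg hl)))
  refine ⟨fun σ => ?_, fun σ => ?_⟩
  · rw [u₁_equilibrium, u₁, restrict_Ici_of_neg σ.F_neg, restrict_Ici_of_neg σ.G_neg]
    refine integral_add_le_of_le hM₁ ?_ ?_ σ.measure_add_le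
    · filter_upwards [ae_nonneg_of_neg σ.F_neg] with t ht
      exact B.U₁_le_of_wait₁_le ht (B.wait₁_equilibrium_le hT hl ht)
    · filter_upwards [ae_nonneg_of_neg σ.G_neg] with t ht
      rw [V₁_eq _ _ ht, add_le_add_iff_left, mul_le_mul_iff_right₀ B.D_pos]
      linarith [B.wait₁_equilibrium_le hT hl ht, B.challengeGain_equilibrium_nonpos hT hl ht]
  · rw [u₂_equilibrium, u₂, restrict_Ici_of_neg σ.F_neg]
    have := integral_add_le_of_le (μ := σ.F.measure) (ν := (0 : Measure ℝ))
      (U := fun t => B.U₂ t σ.q (B.equilibrium₁ hT hl)) (V := fun _ => 0) hM₂ ?_ (by simp)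
      (by simpa using σ.measure_le)
    · simpa using this
    · filter_upwards [ae_nonneg_of_neg σ.F_neg] with t ht
      exact (U₂_le_of_gain_le_cost (B.gain_le_cost_equilibrium hT hl) ht σ.q_measurable
        σ.q_mem).trans (B.U₂_one_le_of_wait₂_le ht (B.wait₂_equilibrium_le hT hl ht))

end Existence

end UltimatumGame

/-! ### Uniqueness and the final statement. -/

namespace UltimatumGame

variable {B : UltimatumGame} {T : ℝ}

lemma pathG_of_rate_eq_zero (hγ : B.γ₁ = 0) (t : ℝ) : B.pathG T t = 0 := by
  simp [pathG, hγ]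

lemma strictMonoOn_pathG (hγ : 0 < B.γ₁) : StrictMonoOn (B.pathG T) (Iic (B.cutoff T)) := by
  intro s hs t ht hst
  rw [pathG, pathG, min_eq_left hs, min_eq_left ht]
  refine mul_lt_mul_of_pos_left (sub_lt_sub_left (Real.exp_lt_exp.2 ?_) _)
    (div_pos (mul_pos B.bluffRatio_pos B.z₁_pos) B.one_sub_z₁_pos)
  exact mul_lt_mul_of_neg_left hst (neg_lt_zero.2 hγ)

/-- The last time at which player 1 challenges in equilibrium. -/
def challengeEnd (B : UltimatumGame) (T : ℝ) : ℝ := if B.γ₁ = 0 then 0 else B.cutoff T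

lemma challengeEnd_of_pos (hγ : 0 < B.γ₁) : B.challengeEnd T = B.cutoff T := if_neg hγ.ne'

lemma challengeEnd_nonneg : 0 ≤ B.challengeEnd T := by
  unfold challengeEnd
  split_ifs
  exacts [le_rfl, B.cutoff_nonneg T]

lemma challengeEnd_lt (hT : 0 < T) : B.challengeEnd T < T := by
  unfold challengeEnd
  split_ifs
  exacts [hT, B.cutoff_lt hT]

namespace IsEquilibrium

variable {σ₁ σ₁' : Strategy₁} {σ₂ σ₂' : Strategy₂}

/-- Injectivity of `level` makes the exit time the same for all equilibria. -/
lemma exitsAt_of_level (h : B.IsEquilibrium σ₁ σ₂) (hl : B.level T = 1) : ExitsAt σ₁ σ₂ T := by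
  obtain ⟨S, hS⟩ := h.exists_exitsAt
  rwa [← B.strictMono_level.injective ((h.level_eq_one hS).trans hl.symm)]

section ExitsAt

variable (h : B.IsEquilibrium σ₁ σ₂) (hT : ExitsAt σ₁ σ₂ T)
include h hT

/-- If `γ₁ = 0` there are no justified challenges to imitate and `G₁` vanishes, so the last
challenge time must be `0` even when the cutoff is positive. -/
lemma G_eq_of_challengeEnd_le {t : ℝ} (ht : B.challengeEnd T ≤ t) :
    σ₁.G t = σ₁.G (B.challengeEnd T) := by
  rcases B.γ₁_nonneg.eq_or_lt with hγ | hγ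
  · rw [h.G_eq_pathG hT (challengeEnd_nonneg.trans ht), h.G_eq_pathG hT challengeEnd_nonneg,
      pathG_of_rate_eq_zero hγ.symm, pathG_of_rate_eq_zero hγ.symm]
  · rw [challengeEnd_of_pos hγ] at ht ⊢
    exact h.G_const hT ht

lemma strictMonoOn_G : StrictMonoOn σ₁.G (Icc 0 (B.challengeEnd T)) := by
  rcases B.γ₁_nonneg.eq_or_lt with hγ | hγ
  · rw [challengeEnd, if_pos hγ.symm, Icc_self]
    exact strictMonoOn_singleton _
  · rw [challengeEnd_of_pos hγ]
    intro s hs t ht hst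
    rw [h.G_eq_pathG hT hs.1, h.G_eq_pathG hT ht.1]
    exact strictMonoOn_pathG hγ hs.2 ht.2 hst

lemma F₁_add_G_challengeEnd : σ₁.F T + σ₁.G (B.challengeEnd T) = 1 := by
  rw [← h.F₁_add_G_exit hT, h.G_eq_of_challengeEnd_le hT (t := B.cutoff T)]
  unfold challengeEnd
  split_ifs
  exacts [B.cutoff_nonneg T, le_rfl]

lemma ae_q_mem (hγ : 0 < B.γ₁) : ∀ᵐ t, (t ∈ Icc 0 (B.cutoff T) → σ₂.q t ∈ Ioo (0 : ℝ) 1) ∧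
    (t ∈ Ioc (B.cutoff T) T → σ₂.q t = 1) := by
  filter_upwards [h.ae_q_eq hT hγ, (volume : Measure ℝ).ae_ne (B.cutoff T),
    (volume : Measure ℝ).ae_ne T] with t ht h1 h2
  refine ⟨fun hm => ?_, fun hm => ht.2 ⟨hm.1, lt_of_le_of_ne hm.2 h2⟩⟩
  have hlt : t < B.cutoff T := lt_of_le_of_ne hm.2 h1
  have htT := hlt.trans (B.cutoff_lt hT.pos)
  rw [ht.1 ⟨hm.1, hlt⟩]
  exact ⟨B.yieldProb_pos htT, B.yieldProb_lt_one hm.1 hlt htT⟩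

end ExitsAt

section Uniqueness

variable (h : B.IsEquilibrium σ₁ σ₂) (hT : ExitsAt σ₁ σ₂ T) (h' : B.IsEquilibrium σ₁' σ₂')
  (hT' : ExitsAt σ₁' σ₂' T)
include h hT h' hT'

lemma F₁_unique : σ₁.F = σ₁'.F := by
  have key : ∀ t ∈ Icc 0 T, σ₁.F t = σ₁'.F t := fun t ht => by
    rw [h.F₁_eq_path₁ hT ht, h'.F₁_eq_path₁ hT' ht]
  ext t
  rcases lt_or_ge t 0 with h0 | h0
  · rw [σ₁.F_neg t h0, σ₁'.F_neg t h0]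
  rcases le_total t T with htT | htT
  · exact key t ⟨h0, htT⟩
  · rw [hT.const₁ t htT, hT'.const₁ t htT, key T ⟨hT.pos.le, le_rfl⟩]

lemma F₂_unique : σ₂.F = σ₂'.F := by
  have key : ∀ t ∈ Icc 0 T, σ₂.F t = σ₂'.F t := fun t ht => by
    rw [h.F₂_eq_path₂ hT ht, h'.F₂_eq_path₂ hT' ht]
  ext t
  rcases lt_or_ge t 0 with h0 | h0
  · rw [σ₂.F_neg t h0, σ₂'.F_neg t h0]
  rcases le_total t T with htT | htT
  · exact key t ⟨h0, htT⟩
  · rw [hT.const₂ t htT, hT'.const₂ t htT, key T ⟨hT.pos.le, le_rfl⟩]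

lemma G_unique : σ₁.G = σ₁'.G := by
  ext t
  rcases lt_or_ge t 0 with h0 | h0
  · rw [σ₁.G_neg t h0, σ₁'.G_neg t h0]
  · rw [h.G_eq_pathG hT h0, h'.G_eq_pathG hT' h0]

lemma q_unique (hγ : 0 < B.γ₁) :
    ∀ᵐ t ∂(volume : Measure ℝ), t ∈ Icc 0 T → σ₂.q t = σ₂'.q t := by
  filter_upwards [h.ae_q_eq hT hγ, h'.ae_q_eq hT' hγ, (volume : Measure ℝ).ae_ne (B.cutoff T),
    (volume : Measure ℝ).ae_ne T] with t ht ht' h1 h2 hm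
  rcases lt_or_gt_of_ne h1 with hlt | hlt
  · rw [ht.1 ⟨hm.1, hlt⟩, ht'.1 ⟨hm.1, hlt⟩]
  · have hmem : t ∈ Ioo (B.cutoff T) T := ⟨hlt, lt_of_le_of_ne hm.2 h2⟩
    rw [ht.2 hmem, ht'.2 hmem]

end Uniqueness

end IsEquilibrium

end UltimatumGame

end

theorem theorem1 (B : UltimatumGame) :
    (∃ (σ₁ : Strategy₁) (σ₂ : Strategy₂), B.IsEquilibrium σ₁ σ₂) ∧
    ∃ T T₁ : ℝ, 0 ≤ T₁ ∧ T₁ < T ∧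
      (∀ (σ₁ : Strategy₁) (σ₂ : Strategy₂), B.IsEquilibrium σ₁ σ₂ →
        -- concessions: strictly increasing on (0,T), constant from T on
        (StrictMonoOn σ₁.F (Ioo 0 T) ∧ StrictMonoOn σ₂.F (Ioo 0 T) ∧
          (∀ t, T ≤ t → σ₁.F t = σ₁.F T) ∧ (∀ t, T ≤ t → σ₂.F t = σ₂.F T)) ∧
        -- concessions: no atoms in (0,T], and at most one of the two has an atom at 0
        ((∀ t ∈ Ioc 0 T, jump σ₁.F t = 0 ∧ jump σ₂.F t = 0) ∧
          (jump σ₁.F 0 = 0 ∨ jump σ₂.F 0 = 0)) ∧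
        -- challenges: atomless, strictly increasing on [0,T₁], constant from T₁ on
        ((∀ t ∈ Icc 0 T, jump σ₁.G t = 0) ∧ StrictMonoOn σ₁.G (Icc 0 T₁) ∧
          (∀ t, T₁ ≤ t → σ₁.G t = σ₁.G T₁)) ∧
        -- responses to challenges
        (0 < B.γ₁ → ∀ᵐ t ∂(volume : Measure ℝ),
          (t ∈ Icc 0 T₁ → σ₂.q t ∈ Ioo (0 : ℝ) 1) ∧ (t ∈ Ioc T₁ T → σ₂.q t = 1)) ∧
        -- exit of the unjustified types
        (σ₁.F T + σ₁.G T₁ = 1 ∧ σ₂.F T = 1)) ∧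
      -- uniqueness
      (∀ (σ₁ σ₁' : Strategy₁) (σ₂ σ₂' : Strategy₂),
        B.IsEquilibrium σ₁ σ₂ → B.IsEquilibrium σ₁' σ₂' →
          σ₁.F = σ₁'.F ∧ σ₂.F = σ₂'.F ∧ σ₁.G = σ₁'.G ∧
          (0 < B.γ₁ → ∀ᵐ t ∂(volume : Measure ℝ), t ∈ Icc 0 T → σ₂.q t = σ₂'.q t)) := by
  -- `T` is fixed by the parameters alone, before any equilibrium is considered.
  obtain ⟨T, hT, hl⟩ := B.exists_level_eq_one
  refine ⟨⟨_, _, B.isEquilibrium_equilibrium hT hl⟩, T, B.challengeEnd T,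
    UltimatumGame.challengeEnd_nonneg, UltimatumGame.challengeEnd_lt hT,
    fun σ₁ σ₂ h => ?_, fun σ₁ σ₁' σ₂ σ₂' h h' => ?_⟩
  · have hE := h.exitsAt_of_level hl
    refine ⟨⟨hE.strictMonoOn₁.mono Ioo_subset_Ico_self, hE.strictMonoOn₂.mono Ioo_subset_Ico_self,
      hE.const₁, hE.const₂⟩,
      ⟨fun t ht => ⟨(h.jump_F₁ hE ht).1, (h.jump_F₂ hE ht).1⟩, h.jump_zero_or⟩,
      ⟨fun t _ => h.jump_G t, h.strictMonoOn_G hE, fun t => h.G_eq_of_challengeEnd_le hE⟩,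
      fun hγ => ?_, h.F₁_add_G_challengeEnd hE, h.F₂_exit hE⟩
    rw [UltimatumGame.challengeEnd_of_pos hγ]
    exact h.ae_q_mem hE hγ
  · have hE := h.exitsAt_of_level hl
    have hE' := h'.exitsAt_of_level hl
    exact ⟨h.F₁_unique hE h' hE', h.F₂_unique hE h' hE', h.G_unique hE h' hE',
      h.q_unique hE h' hE'⟩
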